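/- Let $a,q\in(0,1)$ and $\alpha\in(0,\infty)$. Let $\mathcal A_\infty$ be the set of $\phi\in L^1([0,\infty))$ with $0\le\phi\le1$ Lebesgue-a.e. and $\int_0^\infty\phi(x)\,dx=1$, and for $\phi\in\mathcal A_\infty$ let $\mu_\phi$ be the measure on $[0,\infty)$ with density $\phi$. For a continuous potential $V:[0,\infty)\to\mathbb R$ such that $-\log|x-y|+\frac12V(x)+\frac12V(y)$ is bounded below on $\{(x,y)\in[0,\infty)^2:x\ne y\}$, put $$I_V(\mu)=\iint_{x\ne y}\Big(-\log|x-y|+\tfrac12V(x)+\tfrac12V(y)\Big)\,d\mu(x)\,d\mu(y)\in(-\infty,\infty],\qquad F_V=\inf_{\phi\in\mathcal A_\infty}I_V(\mu_\phi).$$ For $\alpha\ge1$ and $y\in\mathbb R$ let (with the convention $0\log0=0$, and by continuity at $x=0$) $$\mathcal V_y(x)=(\log a^{-1})\,x+(\log q^{-1})\min(x,y)-(\alpha-1)\big[\log(x+\alpha-1)-1\big]+x\log\frac{x}{x+\alpha-1},$$ $$F_\alpha(y)=F_{\mathcal V_y},\qquad C_\alpha=-\frac{(\alpha-1)^2\log(\alpha-1)-\alpha^2\log\alpha+3\alpha}{2},$$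 $$\mathcal F_\alpha(y)=(\log q^{-1})\frac{y^2-2y}{2}-\alpha\log(1-a)+\frac{\log a}{2}+C_\alpha+F_\alpha(y),$$ and for $\alpha\in(0,1)$ let $$\begin{aligned}\mathcal F_\alpha(y)={}&(\log q^{-1})\frac{y^2-2y\alpha+2\alpha-2\alpha^2}{2}-(\log q^{-1})\int_\alpha^1\max(y+x-1,0)\,dx-\alpha\log(1-a)\\&+\alpha^2\frac{\log a}{2}+\alpha^2C_{\alpha^{-1}}+\alpha^2F_{\alpha^{-1}}\big(y\alpha^{-1}-\alpha^{-1}+1\big).\end{aligned}$$ Then there is $s_0=s_0(a,q,\alpha)\in\mathbb R$ such that for all $s\ge s_0$ the value $\mathcal F_\alpha(s)$ is finite and $$\mathcal F_\alpha(s)=(\log q^{-1})\frac{(s-1)^2}{2}+\alpha\log\frac{1-aq}{1-a}.$$ -/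

import Mathlib

open MeasureTheory
open scoped ENNReal

noncomputable section

namespace SixVertex

/-- The kernel `k_V(x,y) = -log|x-y| + V(x)/2 + V(y)/2`. -/
def kernel (V : ℝ → ℝ) (x y : ℝ) : ℝ :=
  -Real.log |x - y| + V x / 2 + V y / 2

/-- The logarithmic energy `I_V(μ) = ∬_{x ≠ y} k_V(x,y) dμ(x) dμ(y)`, as an extended real: integral
of the positive part minus integral of the negative part. For the potentials used below `k_V` is
bounded from below on `[0,∞)²`, so for a probability measure `μ` on `[0,∞)` the second integral is
finite and the value lies in `(-∞,∞]`. -/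
def logEnergy (V : ℝ → ℝ) (μ : Measure ℝ) : EReal :=
  ((∫⁻ p in {p : ℝ × ℝ | p.1 ≠ p.2}, ENNReal.ofReal (kernel V p.1 p.2) ∂(μ.prod μ) : ℝ≥0∞) : EReal)
  - ((∫⁻ p in {p : ℝ × ℝ | p.1 ≠ p.2}, ENNReal.ofReal (-kernel V p.1 p.2) ∂(μ.prod μ) : ℝ≥0∞)
      : EReal)

/-- The set `𝒜_∞` of functions in `L¹([0,∞))` with `0 ≤ φ ≤ 1` almost everywhere and total
integral `1`. Only the values on `[0,∞)` matter. -/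
def admissible : Set (ℝ → ℝ) :=
  {φ | IntegrableOn φ (Set.Ici 0) ∧
    (∀ᵐ x ∂(volume.restrict (Set.Ici (0 : ℝ))), 0 ≤ φ x ∧ φ x ≤ 1) ∧
    ∫ x in Set.Ici (0 : ℝ), φ x = 1}

/-- The measure `μ_φ` on `[0,∞)` with density `φ`. -/
def densityMeasure (φ : ℝ → ℝ) : Measure ℝ :=
  (volume.restrict (Set.Ici (0 : ℝ))).withDensity fun x => ENNReal.ofReal (φ x)

/-- The equilibrium energy `F_V = inf_{φ ∈ 𝒜_∞} I_V(μ_φ)`. -/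
def equilibriumEnergy (V : ℝ → ℝ) : EReal :=
  ⨅ φ ∈ admissible, logEnergy V (densityMeasure φ)

/-- The external field `𝒱_y` with parameter `α ≥ 1`, as a function of `x ≥ 0`. At `x = 0`, and at
`α = 1`, the conventions `Real.log 0 = 0` and `0 / 0 = 0` give the continuous extension. -/
def externalField (a q α y x : ℝ) : ℝ :=
  Real.log a⁻¹ * x + Real.log q⁻¹ * min x y
    - (α - 1) * (Real.log (x + α - 1) - 1) + x * Real.log (x / (x + α - 1))

/-- `F_α(y)`, the equilibrium energy of `𝒱_y`, for `α ≥ 1`. -/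
def fieldEnergy (a q α y : ℝ) : EReal :=
  equilibriumEnergy (externalField a q α y)

/-- The constant `C_α`, for `α ≥ 1` (with `0 log 0 = 0`). -/
def constC (α : ℝ) : ℝ :=
  -((α - 1) ^ 2 * Real.log (α - 1) - α ^ 2 * Real.log α + 3 * α) / 2

open Classical in
/-- The function `ℱ_α`, for `α > 0`. It takes values in the extended reals, and `ℱ_α(y)` is a
real number exactly if the equilibrium energy in it is one. -/
def rateF (a q α y : ℝ) : EReal :=
  if 1 ≤ α then
    ((Real.log q⁻¹ * ((y ^ 2 - 2 * y) / 2) - α * Real.log (1 - a) + Real.log a / 2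
        + constC α : ℝ) : EReal)
      + fieldEnergy a q α y
  else
    ((Real.log q⁻¹ * ((y ^ 2 - 2 * y * α + 2 * α - 2 * α ^ 2) / 2)
        - Real.log q⁻¹ * (∫ x in α..1, max (y + x - 1) 0)
        - α * Real.log (1 - a) + α ^ 2 * (Real.log a / 2) + α ^ 2 * constC α⁻¹ : ℝ) : EReal)
      + ((α ^ 2 : ℝ) : EReal) * fieldEnergy a q α⁻¹ (y * α⁻¹ - α⁻¹ + 1)

end SixVertex

end

/-! Put `c = a * q` and `β = α - 1`. On `[0, s]` the field is the Meixner potential `pot c β`;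
beyond `s` it drops below `pot c β` but keeps linear growth with slope about `log a⁻¹`. Once `s`
lies to the right of the support of the Meixner equilibrium measure, and far enough for the linear
growth to beat the logarithm, neither minimiser nor minimum depends on `s`. The equilibrium energy
is then a constant and the remaining terms give the parabola. The case `α < 1` is the case `α⁻¹` at
a rescaled argument.

The Meixner minimiser is explicit: `eqDensity` averages, over times `t` in `(0, 1)`, the arcsine
laws on `[lower t, upper t]`. Everything rests on `duality`: `(x - lower t) * (upper t - x)` is
symmetric in `x` and `t`. Hence the arcsine density of time `t` at `x` is, as a function of `t`, the
arcsine density on `[lower x, upper x]`; its integral over `(0, 1)` is at most one, which is the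
upper constraint. The potential of an arcsine law is log-capacity plus Green function
(`integral_log_mul_density`, by Jensen's formula), and by duality again the Green functions at `x`
integrate over the times below `lower x` to half of `pot x - pot base`
(`pot_base_le_and_lintegral_green`). Comparing the final time `1` with `lower x` and `upper x` gives
the Euler–Lagrange conditions `excess_trichotomy`.

For the energy, two independent points are given their times, and by symmetry only pairs whose
second time is the earlier one are kept. At a point `x` of the support at time `T`, the earlier laws
have total potential `(pot x - pot base) / 2 + logCap T`. So the double integral becomes the
integral of `pot` against the density, which cancels in the energy, plus elementary terms
(`energy_eqDensity`).

Minimality combines the Euler–Lagrange inequality, as first-order term, with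
`integral_mul_log_nonpos`, as second-order term: the logarithm is conditionally negative definite,
by Frullani's integral and positive definiteness of `exp (-t|x - y|)`. Growth of the field gives
competitors of finite energy a first moment, which makes all the integrals converge. -/

open Real Set intervalIntegral in
theorem lintegral_Ioo_deriv_of_nonneg {g g' : ℝ → ℝ} {a b : ℝ} (hab : a ≤ b)
    (hcont : ContinuousOn g (Icc a b)) (hderiv : ∀ x ∈ Ioo a b, HasDerivAt g (g' x) x)
    (hpos : ∀ x ∈ Ioo a b, 0 ≤ g' x) :
    ∫⁻ x in Ioo a b, ENNReal.ofReal (g' x) = ENNReal.ofReal (g b - g a) := by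
  have hint := integrableOn_deriv_of_nonneg hcont hderiv hpos
  rw [← integral_eq_sub_of_hasDerivAt_of_le hab hcont hderiv
    ((intervalIntegrable_iff_integrableOn_Ioc_of_le hab).2 hint), integral_of_le hab,
    integral_Ioc_eq_integral_Ioo, ofReal_integral_eq_lintegral_ofReal
      (hint.mono_set Ioo_subset_Ioc_self)]
  exact (ae_restrict_mem measurableSet_Ioo).mono hpos

/-! ### The arcsine law of an interval and its Green function. -/

namespace ArcsineLaw

open Real Set

/-- The density of the arcsine law on `(l, h)`; it vanishes off this interval. -/
noncomputable def density (l h y : ℝ) : ℝ := (π * √((y - l) * (h - y)))⁻¹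

/-- The Green function of `ℂ \ [l, h]` with pole at infinity, on the real line. -/
noncomputable def green (l h x : ℝ) : ℝ :=
  if x ∈ Icc l h then 0 else 2 * log ((√|x - l| + √|x - h|) / √(h - l))

theorem green_of_mem {l h x : ℝ} (hx : x ∈ Icc l h) : green l h x = 0 := if_pos hx

theorem green_of_lt {l h x : ℝ} (hlh : l < h) (hx : h < x) :
    green l h x = 2 * log ((√(x - l) + √(x - h)) / √(h - l)) := by
  rw [green, if_neg (fun H => absurd H.2 (not_le.2 hx)), abs_of_pos (by linarith),
    abs_of_pos (by linarith)]

theorem green_of_gt {l h x : ℝ} (hlh : l < h) (hx : x < l) :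
    green l h x = 2 * log ((√(h - x) + √(l - x)) / √(h - l)) := by
  rw [green, if_neg (fun H => absurd H.1 (not_le.2 hx)), abs_of_neg (by linarith),
    abs_of_neg (by linarith), add_comm]
  simp

theorem green_nonneg {l h : ℝ} (hlh : l < h) (x : ℝ) : 0 ≤ green l h x := by
  have h0 : 0 < √(h - l) := sqrt_pos.2 (by linarith)
  rcases lt_or_ge h x with hx | hx
  · rw [green_of_lt hlh hx]
    refine mul_nonneg (by norm_num) (log_nonneg ?_)
    rw [le_div_iff₀ h0, one_mul]
    exact (sqrt_le_sqrt (by linarith)).trans (le_add_of_nonneg_right (sqrt_nonneg _))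
  rcases lt_or_ge x l with hx' | hx'
  · rw [green_of_gt hlh hx']
    refine mul_nonneg (by norm_num) (log_nonneg ?_)
    rw [le_div_iff₀ h0, one_mul]
    exact (sqrt_le_sqrt (by linarith)).trans (le_add_of_nonneg_right (sqrt_nonneg _))
  · rw [green_of_mem ⟨hx', hx⟩]

theorem hasDerivAt_log_sqrt_add_sqrt {l h y : ℝ} (hl : l < y) (hh : h < y) :
    HasDerivAt (fun y => 2 * log (√(y - l) + √(y - h))) (√((y - l) * (y - h)))⁻¹ y := by
  have h1 : 0 < √(y - l) := sqrt_pos.2 (by linarith)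
  have h2 : 0 < √(y - h) := sqrt_pos.2 (by linarith)
  have d1 : HasDerivAt (fun y => √(y - l)) (1 / (2 * √(y - l))) y :=
    ((hasDerivAt_id y).sub_const l).sqrt (by simp; linarith)
  have d2 : HasDerivAt (fun y => √(y - h)) (1 / (2 * √(y - h))) y :=
    ((hasDerivAt_id y).sub_const h).sqrt (by simp; linarith)
  convert! ((d1.add d2).log (by simp only [Pi.add_apply]; positivity)).const_mul 2 using 1
  rw [sqrt_mul (by linarith)]
  simp only [Pi.add_apply]
  field_simp
  ring

/-- The Green function vanishes at the edge, so outside the interval it is the integral of its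
derivative from the nearest endpoint. This form allows Tonelli between space and time later. -/
theorem lintegral_inv_sqrt_of_le {l h x : ℝ} (hlh : l < h) (hx : h ≤ x) :
    ∫⁻ y in Ioo h x, ENNReal.ofReal (√((y - l) * (y - h)))⁻¹
      = ENNReal.ofReal (2 * log ((√(x - l) + √(x - h)) / √(h - l))) := by
  have h0 : 0 < √(h - l) := sqrt_pos.2 (by linarith)
  have h1 : 0 < √(x - l) := sqrt_pos.2 (by linarith)
  rw [lintegral_Ioo_deriv_of_nonneg (g := fun y => 2 * log (√(y - l) + √(y - h))) hx]
  · rw [log_div (by positivity) h0.ne']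
    simp only [sub_self, sqrt_zero, add_zero]
    ring_nf
  · refine ContinuousOn.mul continuousOn_const (ContinuousOn.log (by fun_prop) fun y hy => ?_)
    have : 0 < √(y - l) := sqrt_pos.2 (by linarith [hy.1])
    positivity
  · exact fun y hy => hasDerivAt_log_sqrt_add_sqrt (by linarith [hy.1]) hy.1
  · exact fun y _ => by positivity

theorem lintegral_inv_sqrt_of_ge {l h x : ℝ} (hlh : l < h) (hx : x ≤ l) :
    ∫⁻ y in Ioo x l, ENNReal.ofReal (√((l - y) * (h - y)))⁻¹
      = ENNReal.ofReal (2 * log ((√(h - x) + √(l - x)) / √(h - l))) := by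
  have h0 : 0 < √(h - l) := sqrt_pos.2 (by linarith)
  have h1 : 0 < √(h - x) := sqrt_pos.2 (by linarith)
  -- The antiderivative is the one for points right of an interval, reflected by `y ↦ -y`.
  rw [lintegral_Ioo_deriv_of_nonneg (g := fun y => -(2 * log (√(-y - -h) + √(-y - -l)))) hx]
  · rw [log_div (by positivity) h0.ne', sub_self, sqrt_zero, add_zero,
      show -l - -h = h - l by ring, show -x - -h = h - x by ring, show -x - -l = l - x by ring]
    ring_nf
  · refine (ContinuousOn.mul continuousOn_const
      (ContinuousOn.log (by fun_prop) fun y hy => ?_)).neg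
    have : 0 < √(-y - -h) := sqrt_pos.2 (by linarith [hy.2])
    positivity
  · intro y hy
    have := ((hasDerivAt_log_sqrt_add_sqrt (y := -y) (l := -h) (h := -l)
      (by linarith [hy.2]) (by linarith [hy.2])).comp y (hasDerivAt_neg y)).neg
    convert! this using 1
    rw [mul_neg, mul_one, neg_neg]
    congr 2
    ring
  · exact fun y _ => by positivity

theorem density_nonneg (l h y : ℝ) : 0 ≤ density l h y := by
  unfold density; positivity

theorem density_eq_zero {l h y : ℝ} (hlh : l ≤ h) (hy : y ∉ Ioo l h) : density l h y = 0 := by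
  have : (y - l) * (h - y) ≤ 0 := by
    rw [mem_Ioo, not_and_or, not_lt, not_lt] at hy
    rcases hy with hy | hy <;> nlinarith
  simp [density, sqrt_eq_zero_of_nonpos this]

@[fun_prop]
theorem measurable_density : Measurable fun p : ℝ × ℝ × ℝ => density p.1 p.2.1 p.2.2 := by
  unfold density; fun_prop

theorem image_cos_Ioo {l h : ℝ} (hlh : l < h) :
    (fun θ => (l + h) / 2 + (h - l) / 2 * cos θ) '' Ioo 0 π = Ioo l h := by
  ext y
  constructor
  · rintro ⟨θ, hθ, rfl⟩
    have h1 : cos θ < 1 := by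
      rw [← cos_zero]; exact cos_lt_cos_of_nonneg_of_le_pi le_rfl hθ.2.le hθ.1
    have h2 : -1 < cos θ := by
      rw [← cos_pi]; exact cos_lt_cos_of_nonneg_of_le_pi hθ.1.le le_rfl hθ.2
    constructor <;> nlinarith
  · intro hy
    have hd : 0 < h - l := by linarith
    have h1 : -1 < (y - (l + h) / 2) / ((h - l) / 2) := by
      rw [lt_div_iff₀ (by linarith)]; linarith [hy.1]
    have h2 : (y - (l + h) / 2) / ((h - l) / 2) < 1 := by
      rw [div_lt_iff₀ (by linarith)]; linarith [hy.2]
    refine ⟨arccos ((y - (l + h) / 2) / ((h - l) / 2)), ⟨arccos_pos.2 h2, ?_⟩, ?_⟩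
    · exact arccos_lt_pi.2 h1
    · simp only
      rw [cos_arccos h1.le h2.le]
      field_simp
      ring

theorem injOn_cos {l h : ℝ} (hlh : l < h) :
    InjOn (fun θ => (l + h) / 2 + (h - l) / 2 * cos θ) (Ioo 0 π) := by
  intro θ hθ θ' hθ' H
  simp only [add_right_inj, mul_eq_mul_left_iff] at H
  rcases H with H | H
  · exact Real.injOn_cos ⟨hθ.1.le, hθ.2.le⟩ ⟨hθ'.1.le, hθ'.2.le⟩ H
  · linarith

theorem hasDerivWithinAt_cos (l h θ : ℝ) (s : Set ℝ) :
    HasDerivWithinAt (fun θ => (l + h) / 2 + (h - l) / 2 * cos θ)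
      ((h - l) / 2 * (-sin θ)) s θ :=
  (((Real.hasDerivAt_cos θ).const_mul _).const_add _).hasDerivWithinAt

/-- The Jacobian cancels the density: in the angle variable the arcsine law is uniform on `(0, π)`.
-/
theorem abs_deriv_mul_density {l h θ : ℝ} (hlh : l < h) (hθ : θ ∈ Ioo 0 π) :
    |(h - l) / 2 * (-sin θ)| * density l h ((l + h) / 2 + (h - l) / 2 * cos θ) = π⁻¹ := by
  have hs : 0 < sin θ := sin_pos_of_mem_Ioo hθ
  have hd : 0 < (h - l) / 2 := by linarith
  have : ((l + h) / 2 + (h - l) / 2 * cos θ - l) * (h - ((l + h) / 2 + (h - l) / 2 * cos θ))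
      = ((h - l) / 2 * sin θ) ^ 2 := by
    rw [mul_pow, sin_sq]; ring
  rw [density, this, sqrt_sq (by positivity), mul_neg, abs_neg, abs_of_pos (by positivity)]
  have := pi_pos
  have : h - l ≠ 0 := by linarith
  field_simp

theorem integral_mul_density {l h : ℝ} (hlh : l < h) (f : ℝ → ℝ) :
    ∫ y, f y * density l h y
      = π⁻¹ * ∫ θ in Ioo 0 π, f ((l + h) / 2 + (h - l) / 2 * cos θ) := by
  rw [← setIntegral_eq_integral_of_forall_compl_eq_zero (s := Ioo l h)
    (fun y hy => by rw [density_eq_zero hlh.le hy, mul_zero]), ← image_cos_Ioo hlh,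
    integral_image_eq_integral_abs_deriv_smul measurableSet_Ioo
      (fun θ _ => hasDerivWithinAt_cos l h θ _) (injOn_cos hlh), ← integral_const_mul]
  refine setIntegral_congr_fun measurableSet_Ioo fun θ hθ => ?_
  simp only [smul_eq_mul]
  rw [← abs_deriv_mul_density hlh hθ]
  ring

theorem lintegral_density {l h : ℝ} (hlh : l < h) :
    ∫⁻ y, ENNReal.ofReal (density l h y) = 1 := by
  rw [← setLIntegral_eq_of_support_subset (s := Ioo l h), ← image_cos_Ioo hlh,
    lintegral_image_eq_lintegral_abs_deriv_mul measurableSet_Ioo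
      (fun θ _ => hasDerivWithinAt_cos l h θ _) (injOn_cos hlh)]
  · rw [setLIntegral_congr_fun (g := fun _ => ENNReal.ofReal π⁻¹) measurableSet_Ioo]
    · rw [setLIntegral_const, volume_Ioo, ← ENNReal.ofReal_mul (by positivity)]
      simp [pi_pos.ne']
    · intro θ hθ
      simp only
      rw [← ENNReal.ofReal_mul (abs_nonneg _), abs_deriv_mul_density hlh hθ]
  · intro y hy
    by_contra H
    simp [density_eq_zero hlh.le H] at hy

end ArcsineLaw

/-! ### The logarithmic potential of the arcsine law, by Jensen's formula and the Joukowski map. -/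

namespace ArcsineLaw

open Real Set

theorem intervalIntegral_comp_cos_two_pi {F : ℝ → ℝ}
    (hF : IntervalIntegrable (fun θ => F (cos θ)) volume 0 (2 * π)) :
    ∫ θ in (0)..(2 * π), F (cos θ) = 2 * ∫ θ in (0)..π, F (cos θ) := by
  have hp := pi_pos
  have h1 : IntervalIntegrable (fun θ => F (cos θ)) volume 0 π :=
    hF.mono_set (by
      rw [uIcc_of_le hp.le, uIcc_of_le (by linarith)]; exact Icc_subset_Icc_right (by linarith))
  have h2 : IntervalIntegrable (fun θ => F (cos θ)) volume π (2 * π) :=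
    hF.mono_set (by
      rw [uIcc_of_le (by linarith), uIcc_of_le (by linarith)]
      exact Icc_subset_Icc_left (by linarith))
  rw [← intervalIntegral.integral_add_adjacent_intervals h1 h2, two_mul (∫ _ in _.._, _)]
  congr 1
  have := intervalIntegral.integral_comp_sub_left (a := 0) (b := π) (fun θ => F (cos θ)) (2 * π)
  rw [show 2 * π - π = π by ring, sub_zero] at this
  rw [← this]
  simp [cos_two_pi_sub]

/-- With `u = e^{iθ}`, so that `u + u⁻¹ = 2 cos θ`, the product `(u - z)(u - z⁻¹)` equals `-u (2w -
2 cos θ)`, and `u` has modulus one. -/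
theorem abs_sub_two_cos {z : ℂ} {w : ℝ} (hz : z ≠ 0) (hw : z + z⁻¹ = 2 * w) (θ : ℝ) :
    |2 * w - 2 * cos θ| = ‖circleMap 0 1 θ - z‖ * ‖circleMap 0 1 θ - z⁻¹‖ := by
  have hone : ‖circleMap 0 1 θ‖ = 1 := by simp
  have he : circleMap 0 1 θ ≠ 0 := by
    intro H; rw [H] at hone; simp at hone
  have h2 : circleMap 0 1 θ + (circleMap 0 1 θ)⁻¹ = 2 * Complex.cos θ := by
    rw [Complex.two_cos]
    simp [circleMap, ← Complex.exp_neg]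
  have key : (circleMap 0 1 θ - z) * (circleMap 0 1 θ - z⁻¹)
      = -(circleMap 0 1 θ * ((2 * w - 2 * cos θ : ℝ) : ℂ)) := by
    push_cast
    rw [← hw, ← h2]
    field_simp
    ring
  rw [← norm_mul, key, norm_neg, norm_mul, hone, one_mul, Complex.norm_real, Real.norm_eq_abs]

theorem log_abs_sub_two_cos_ae {z : ℂ} {w : ℝ} (hz : z ≠ 0) (hw : z + z⁻¹ = 2 * w) :
    ∀ᵐ θ : ℝ, log |2 * w - 2 * cos θ|
      = log ‖circleMap 0 1 θ - z‖ + log ‖circleMap 0 1 θ - z⁻¹‖ := by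
  -- When `z` is on the unit circle a factor can vanish, and the convention `log 0 = 0` then spoils
  -- the product rule; this happens for only countably many angles.
  have hc : ∀ u : ℂ, ∀ᵐ θ : ℝ, circleMap 0 1 θ ≠ u := by
    intro u
    have : ((circleMap 0 1) ⁻¹' {u} : Set ℝ).Countable :=
      (countable_singleton u).preimage_circleMap 0 one_ne_zero
    filter_upwards [this.ae_notMem volume] with θ hθ using hθ
  filter_upwards [hc z, hc z⁻¹] with θ h1 h2
  rw [abs_sub_two_cos hz hw, log_mul (norm_ne_zero_iff.2 (sub_ne_zero.2 h1))
    (norm_ne_zero_iff.2 (sub_ne_zero.2 h2))]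

theorem intervalIntegrable_log_abs_sub_two_cos {z : ℂ} {w : ℝ} (hz : z ≠ 0)
    (hw : z + z⁻¹ = 2 * w) :
    IntervalIntegrable (fun θ => log |2 * w - 2 * cos θ|) volume 0 (2 * π) := by
  have h1 := circleIntegrable_log_norm_sub_const (a := z) (c := 0) 1
  have h2 := circleIntegrable_log_norm_sub_const (a := z⁻¹) (c := 0) 1
  refine (IntervalIntegrable.add h1 h2).congr_ae (ae_restrict_of_ae ?_)
  filter_upwards [log_abs_sub_two_cos_ae hz hw] with θ hθ using hθ.symm

/-- The circle average of `log ‖u - z‖` is `log⁺ ‖z‖`. Since `‖z‖ ≥ 1`, the factor with `z`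
contributes `log ‖z‖` and the one with `z⁻¹` nothing. -/
theorem integral_log_abs_sub_two_cos {z : ℂ} {w : ℝ} (hz : 1 ≤ ‖z‖) (hw : z + z⁻¹ = 2 * w) :
    ∫ θ in (0)..π, log |2 * w - 2 * cos θ| = π * log ‖z‖ := by
  have hz0 : z ≠ 0 := by rintro rfl; simp at hz; linarith
  have h1 := circleIntegrable_log_norm_sub_const (a := z) (c := 0) 1
  have h2 := circleIntegrable_log_norm_sub_const (a := z⁻¹) (c := 0) 1
  have e1 := circleAverage_log_norm_sub_const_eq_posLog (a := z)
  have e2 := circleAverage_log_norm_sub_const_eq_posLog (a := z⁻¹)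
  rw [posLog_eq_log (by rwa [abs_norm])] at e1
  rw [(posLog_eq_zero_iff _).2 (by rw [abs_norm, norm_inv]; exact inv_le_one_of_one_le₀ hz)] at e2
  have e3 : circleAverage (fun u => log ‖u - z‖ + log ‖u - z⁻¹‖) 0 1 = log ‖z‖ := by
    rw [circleAverage_fun_add h1 h2, e1, e2, add_zero]
  have e4 := intervalIntegral_comp_cos_two_pi (F := fun u => log |2 * w - 2 * u|)
    (intervalIntegrable_log_abs_sub_two_cos hz0 hw)
  rw [circleAverage_def, smul_eq_mul, inv_mul_eq_iff_eq_mul₀ (by positivity)] at e3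
  have e5 : ∫ θ in (0)..(2 * π), log |2 * w - 2 * cos θ|
      = ∫ θ in (0)..(2 * π), (log ‖circleMap 0 1 θ - z‖ + log ‖circleMap 0 1 θ - z⁻¹‖) :=
    intervalIntegral.integral_congr_ae
      ((log_abs_sub_two_cos_ae hz0 hw).mono fun θ hθ _ => hθ)
  linarith [e3, e4, e5]

/-- Inside the interval the preimage is `e^{i arccos w}`, of modulus one; outside it is real, and
its logarithm is the closed form of the Green function. -/
theorem exists_joukowski {l h : ℝ} (hlh : l < h) (x : ℝ) :
    ∃ z : ℂ, 1 ≤ ‖z‖ ∧ z + z⁻¹ = 2 * (((x - (l + h) / 2) / ((h - l) / 2) : ℝ) : ℂ) ∧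
      log ‖z‖ = green l h x := by
  have hd : 0 < h - l := by linarith
  -- Here `p` and `r` stand for the square roots of the distances from `x` to the far and the near
  -- endpoint. As `p² - r² = h - l`, the inverse of `(p + r)² / (h - l)` is `(p - r)² / (h - l)`.
  have key : ∀ p r : ℝ, 0 ≤ r → p ^ 2 - r ^ 2 = h - l → 0 < p →
      1 ≤ (p + r) ^ 2 / (h - l) ∧ (p + r) ^ 2 / (h - l) + ((p + r) ^ 2 / (h - l))⁻¹
        = 2 * (p ^ 2 + r ^ 2) / (h - l) ∧
      log ((p + r) ^ 2 / (h - l)) = 2 * log ((p + r) / √(h - l)) := by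
    intro p r hr hpr hp
    refine ⟨?_, ?_, ?_⟩
    · rw [le_div_iff₀ hd]; nlinarith
    · rw [← hpr] at hd ⊢
      have : p + r ≠ 0 := by positivity
      field_simp
      ring
    · rw [← log_rpow (by positivity)]
      congr 1
      rw [rpow_two, div_pow, sq_sqrt hd.le]
  rcases lt_or_ge h x with hx | hx
  · obtain ⟨k1, k2, k3⟩ := key √(x - l) √(x - h) (sqrt_nonneg _)
      (by rw [sq_sqrt (by linarith), sq_sqrt (by linarith)]; ring) (sqrt_pos.2 (by linarith))
    refine ⟨(((√(x - l) + √(x - h)) ^ 2 / (h - l) : ℝ) : ℂ), ?_, ?_, ?_⟩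
    · rw [Complex.norm_real, norm_of_nonneg (by positivity)]; exact k1
    · rw [← Complex.ofReal_inv, ← Complex.ofReal_add, k2, sq_sqrt (by linarith),
        sq_sqrt (by linarith)]
      norm_cast
      have : h - l ≠ 0 := hd.ne'
      field_simp
      ring
    · rw [Complex.norm_real, norm_of_nonneg (by positivity), green_of_lt hlh hx, k3]
  rcases lt_or_ge x l with hx' | hx'
  · obtain ⟨k1, k2, k3⟩ := key √(h - x) √(l - x) (sqrt_nonneg _)
      (by rw [sq_sqrt (by linarith), sq_sqrt (by linarith)]; ring) (sqrt_pos.2 (by linarith))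
    refine ⟨((-((√(h - x) + √(l - x)) ^ 2 / (h - l)) : ℝ) : ℂ), ?_, ?_, ?_⟩
    · rw [Complex.norm_real, norm_neg, norm_of_nonneg (by positivity)]; exact k1
    · rw [← Complex.ofReal_inv, ← Complex.ofReal_add, inv_neg, ← neg_add, k2,
        sq_sqrt (by linarith), sq_sqrt (by linarith)]
      norm_cast
      have : h - l ≠ 0 := hd.ne'
      field_simp
      ring
    · rw [Complex.norm_real, norm_neg, norm_of_nonneg (by positivity), green_of_gt hlh hx', k3]
  · set w := (x - (l + h) / 2) / ((h - l) / 2) with hw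
    have w1 : -1 ≤ w := by rw [hw, le_div_iff₀ (by linarith)]; linarith
    have w2 : w ≤ 1 := by rw [hw, div_le_iff₀ (by linarith)]; linarith
    refine ⟨Complex.exp (arccos w * Complex.I), ?_, ?_, ?_⟩
    · rw [Complex.norm_exp_ofReal_mul_I]
    · rw [← Complex.exp_neg, ← neg_mul, ← Complex.two_cos, ← Complex.ofReal_cos,
        cos_arccos w1 w2]
    · rw [Complex.norm_exp_ofReal_mul_I, log_one, green_of_mem ⟨hx', hx⟩]

/-- The logarithmic potential of the arcsine law on `[l, h]`. -/
theorem integral_log_mul_density {l h : ℝ} (hlh : l < h) (x : ℝ) :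
    ∫ y, log |x - y| * density l h y = log ((h - l) / 4) + green l h x := by
  obtain ⟨z, hz1, hz2, hz3⟩ := exists_joukowski hlh x
  have hz0 : z ≠ 0 := by rintro rfl; simp at hz1; linarith
  have hd : 0 < h - l := by linarith
  set w := (x - (l + h) / 2) / ((h - l) / 2) with hw
  have hI := intervalIntegrable_log_abs_sub_two_cos hz0 hz2
  have hI' : IntervalIntegrable (fun θ => log |2 * w - 2 * cos θ|) volume 0 π :=
    hI.mono_set (by
      rw [uIcc_of_le pi_pos.le, uIcc_of_le (by linarith [pi_pos])]
      exact Icc_subset_Icc_right (by linarith [pi_pos]))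
  have hne : ∀ᵐ θ : ℝ, θ ∈ Ioc 0 π → log |x - ((l + h) / 2 + (h - l) / 2 * cos θ)|
      = log ((h - l) / 4) + log |2 * w - 2 * cos θ| := by
    have : ∀ᵐ θ : ℝ, θ ≠ arccos w := by
      simp [ae_iff]
    filter_upwards [this] with θ hθ hθ'
    have h2 : 2 * w - 2 * cos θ ≠ 0 := by
      intro H
      apply hθ
      rw [show w = cos θ by linarith, arccos_cos hθ'.1.le hθ'.2]
    rw [← log_mul (by positivity) (abs_ne_zero.2 h2)]
    congr 1
    have hb : |(h - l) / 4| = (h - l) / 4 := abs_of_pos (by linarith)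
    rw [← hb, ← abs_mul]
    congr 1
    rw [hw]
    field_simp
    ring
  rw [integral_mul_density hlh, ← integral_Ioc_eq_integral_Ioo,
    ← intervalIntegral.integral_of_le pi_pos.le,
    intervalIntegral.integral_congr_ae (by rwa [uIoc_of_le pi_pos.le]),
    intervalIntegral.integral_add intervalIntegrable_const hI',
    integral_log_abs_sub_two_cos hz1 hz2, hz3, intervalIntegral.integral_const, smul_eq_mul]
  have := pi_pos
  field_simp
  ring

end ArcsineLaw

/-! ### Monotonicity from the derivative, and Tonelli for a region sliced in two ways. -/

open Real Set intervalIntegral in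
theorem le_of_hasDerivAt_nonneg {g g' : ℝ → ℝ} {a b : ℝ} (hab : a ≤ b)
    (hcont : ContinuousOn g (Icc a b)) (hderiv : ∀ x ∈ Ioo a b, HasDerivAt g (g' x) x)
    (hpos : ∀ x ∈ Ioo a b, 0 ≤ g' x) : g a ≤ g b := by
  refine monotoneOn_of_deriv_nonneg (convex_Icc a b) hcont ?_ ?_ (left_mem_Icc.2 hab)
    (right_mem_Icc.2 hab) hab
  · rw [interior_Icc]
    exact fun x hx => (hderiv x hx).differentiableAt.differentiableWithinAt
  · rw [interior_Icc]
    exact fun x hx => by rw [(hderiv x hx).deriv]; exact hpos x hx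

open Set in
theorem lintegral_lintegral_swap_of_mem_iff {A B : Set ℝ} {S T : ℝ → Set ℝ}
    (hA : MeasurableSet A) (hB : MeasurableSet B) (hS : ∀ t, MeasurableSet (S t))
    (hT : ∀ y, MeasurableSet (T y)) (hR : MeasurableSet {p : ℝ × ℝ | p.1 ∈ A ∧ p.2 ∈ S p.1})
    {e : ℝ → ℝ → ℝ≥0∞} (he : Measurable (Function.uncurry e))
    (h : ∀ t y, (t ∈ A ∧ y ∈ S t) ↔ (y ∈ B ∧ t ∈ T y)) :
    ∫⁻ t in A, ∫⁻ y in S t, e t y = ∫⁻ y in B, ∫⁻ t in T y, e t y := by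
  have hF : Measurable ({p : ℝ × ℝ | p.1 ∈ A ∧ p.2 ∈ S p.1}.indicator (Function.uncurry e)) :=
    he.indicator hR
  have h1 : ∫⁻ t in A, ∫⁻ y in S t, e t y
      = ∫⁻ t, ∫⁻ y, ({p : ℝ × ℝ | p.1 ∈ A ∧ p.2 ∈ S p.1}.indicator (Function.uncurry e)) (t, y) := by
    rw [← lintegral_indicator hA]
    refine lintegral_congr fun t => ?_
    by_cases ht : t ∈ A
    · rw [indicator_of_mem ht, ← lintegral_indicator (hS t)]
      refine lintegral_congr fun y => ?_
      by_cases hy : y ∈ S t <;> simp [indicator, ht, hy]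
    · simp [indicator, ht]
  have h2 : ∫⁻ y in B, ∫⁻ t in T y, e t y
      = ∫⁻ y, ∫⁻ t, ({p : ℝ × ℝ | p.1 ∈ A ∧ p.2 ∈ S p.1}.indicator (Function.uncurry e)) (t, y) := by
    rw [← lintegral_indicator hB]
    refine lintegral_congr fun y => ?_
    by_cases hy : y ∈ B
    · rw [indicator_of_mem hy, ← lintegral_indicator (hT y)]
      refine lintegral_congr fun t => ?_
      by_cases ht : t ∈ T y <;> simp [indicator, h, ht, hy]
    · simp [indicator, h, hy]
  rw [h1, h2]
  exact lintegral_lintegral_swap hF.aemeasurable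

/-! ### The growing family of Meixner supports, its duality, and the time integral of the Green
functions. -/

namespace Meixner

open Real Set

/-- Lower end of the support of the arcsine law at time `t`. -/
noncomputable def lower (c β t : ℝ) : ℝ := (√(c * (t + β)) - √t) ^ 2 / (1 - c)

/-- Upper end of the support of the arcsine law at time `t`. -/
noncomputable def upper (c β t : ℝ) : ℝ := (√(c * (t + β)) + √t) ^ 2 / (1 - c)

/-- The point to which the supports shrink as `t → 0`. -/
noncomputable def base (c β : ℝ) : ℝ := c * β / (1 - c)

/-- The Meixner potential. -/
noncomputable def pot (c β x : ℝ) : ℝ := -x * log c + β + x * log x - (x + β) * log (x + β)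

@[fun_prop]
theorem continuous_lower (c β : ℝ) : Continuous (lower c β) := by
  unfold lower; fun_prop

@[fun_prop]
theorem continuous_upper (c β : ℝ) : Continuous (upper c β) := by
  unfold upper; fun_prop

@[fun_prop]
theorem continuous_pot (c β : ℝ) : Continuous (pot c β) := by
  unfold pot
  have h1 : Continuous fun x : ℝ => x * log x := continuous_mul_log
  have h2 : Continuous fun x : ℝ => (x + β) * log (x + β) :=
    continuous_mul_log.comp (continuous_id.add continuous_const)
  fun_prop

variable {c β : ℝ}

theorem lower_nonneg (hc1 : c < 1) (t : ℝ) : 0 ≤ lower c β t :=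
  div_nonneg (sq_nonneg _) (by linarith)

theorem upper_sub_lower (hc1 : c < 1) (t : ℝ) :
    upper c β t - lower c β t = 4 * (√(c * (t + β)) * √t) / (1 - c) := by
  have : 1 - c ≠ 0 := by linarith
  unfold upper lower
  field_simp
  ring

theorem lower_le_upper (hc1 : c < 1) (t : ℝ) : lower c β t ≤ upper c β t := by
  rw [← sub_nonneg, upper_sub_lower hc1]
  have : 0 < 1 - c := by linarith
  positivity

theorem lower_lt_upper (hc0 : 0 < c) (hc1 : c < 1) (hβ : 0 ≤ β) {t : ℝ} (ht : 0 < t) :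
    lower c β t < upper c β t := by
  rw [← sub_pos, upper_sub_lower hc1]
  have : 0 < 1 - c := by linarith
  positivity

theorem lower_add_upper (hc0 : 0 < c) (hc1 : c < 1) (hβ : 0 ≤ β) {t : ℝ} (ht : 0 ≤ t) :
    lower c β t + upper c β t = 2 * (c * (t + β) + t) / (1 - c) := by
  have : 1 - c ≠ 0 := by linarith
  have h1 : √(c * (t + β)) ^ 2 = c * (t + β) := sq_sqrt (by positivity)
  have h2 : √t ^ 2 = t := sq_sqrt ht
  unfold upper lower
  field_simp
  linear_combination 2 * h1 + 2 * h2

theorem lower_mul_upper (hc0 : 0 < c) (hc1 : c < 1) (hβ : 0 ≤ β) {t : ℝ} (ht : 0 ≤ t) :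
    lower c β t * upper c β t = ((c * (t + β) - t) / (1 - c)) ^ 2 := by
  have : 1 - c ≠ 0 := by linarith
  have h1 : √(c * (t + β)) ^ 2 = c * (t + β) := sq_sqrt (by positivity)
  have h2 : √t ^ 2 = t := sq_sqrt ht
  rw [show c * (t + β) - t = √(c * (t + β)) ^ 2 - √t ^ 2 by rw [h1, h2]]
  unfold upper lower
  field_simp
  ring

/-- Self-duality: position and time may be exchanged. -/
theorem duality (hc0 : 0 < c) (hc1 : c < 1) (hβ : 0 ≤ β) {x t : ℝ} (hx : 0 ≤ x) (ht : 0 ≤ t) :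
    (x - lower c β t) * (upper c β t - x) = (t - lower c β x) * (upper c β x - t) := by
  have h1 := lower_add_upper hc0 hc1 hβ ht
  have h2 := lower_add_upper hc0 hc1 hβ hx
  have h3 := lower_mul_upper hc0 hc1 hβ ht
  have h4 := lower_mul_upper hc0 hc1 hβ hx
  have : 1 - c ≠ 0 := by linarith
  -- Sum and product of the endpoints are polynomial in time, so the claim becomes a polynomial
  -- identity.
  have e : x * (2 * (c * (t + β) + t) / (1 - c)) - t * (2 * (c * (x + β) + x) / (1 - c))
      - ((c * (t + β) - t) / (1 - c)) ^ 2 + ((c * (x + β) - x) / (1 - c)) ^ 2 - x ^ 2 + t ^ 2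
      = 0 := by
    field_simp
    ring
  linear_combination x * h1 - t * h2 - h3 + h4 + e

theorem base_nonneg (hc0 : 0 < c) (hc1 : c < 1) (hβ : 0 ≤ β) : 0 ≤ base c β := by
  have : 0 < 1 - c := by linarith
  unfold base; positivity

theorem lt_upper (hc0 : 0 < c) (hc1 : c < 1) (hβ : 0 ≤ β) {t : ℝ} (ht : 0 < t) :
    t < upper c β t := by
  have h1 : √(c * (t + β)) ^ 2 = c * (t + β) := sq_sqrt (by positivity)
  have h2 : √t ^ 2 = t := sq_sqrt ht.le
  unfold upper
  rw [lt_div_iff₀ (by linarith)]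
  nlinarith [mul_nonneg (sqrt_nonneg (c * (t + β))) (sqrt_nonneg t), mul_pos hc0 ht,
    mul_nonneg hc0.le hβ]

theorem base_lt_upper (hc0 : 0 < c) (hc1 : c < 1) (hβ : 0 ≤ β) {t : ℝ} (ht : 0 < t) :
    base c β < upper c β t := by
  have h1 : √(c * (t + β)) ^ 2 = c * (t + β) := sq_sqrt (by positivity)
  have h2 : √t ^ 2 = t := sq_sqrt ht.le
  unfold upper base
  apply div_lt_div_of_pos_right _ (by linarith)
  nlinarith [mul_nonneg (sqrt_nonneg (c * (t + β))) (sqrt_nonneg t), mul_pos hc0 ht]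

theorem lower_le_max (hc0 : 0 < c) (hc1 : c < 1) (hβ : 0 ≤ β) {t : ℝ} (ht : 0 ≤ t) :
    lower c β t ≤ max t (base c β) := by
  have hd : 0 < 1 - c := by linarith
  have h1 : √(c * (t + β)) ^ 2 = c * (t + β) := sq_sqrt (by positivity)
  have h2 : √t ^ 2 = t := sq_sqrt ht
  rcases le_total √t √(c * (t + β)) with H | H
  · refine le_trans ?_ (le_max_right _ _)
    unfold lower base
    apply div_le_div_of_nonneg_right _ hd.le
    nlinarith [mul_le_mul_of_nonneg_left H (sqrt_nonneg t)]
  · refine le_trans ?_ (le_max_left _ _)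
    unfold lower
    rw [div_le_iff₀ hd]
    nlinarith [mul_le_mul_of_nonneg_left H (sqrt_nonneg (c * (t + β))), mul_nonneg hc0.le hβ]

/-- By duality `x` is outside the support at time `t` exactly if `t` is outside `[lower x, upper
x]`. The condition `base < x` decides on which side of the support `x` lies, because every support
at a positive time reaches beyond `base`. -/
theorem upper_lt_iff (hc0 : 0 < c) (hc1 : c < 1) (hβ : 0 ≤ β) {x t : ℝ} (hx : 0 < x)
    (ht : 0 < t) : upper c β t < x ↔ t < lower c β x ∧ base c β < x := by
  have hd := duality hc0 hc1 hβ hx.le ht.le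
  have ht1 := lower_lt_upper hc0 hc1 hβ ht
  have hx1 := lower_lt_upper hc0 hc1 hβ hx
  have ht2 := lt_upper hc0 hc1 hβ ht
  have hx2 := lt_upper hc0 hc1 hβ hx
  have ht3 := base_lt_upper hc0 hc1 hβ ht
  constructor
  · intro H
    refine ⟨?_, by linarith⟩
    by_contra! H'
    nlinarith [mul_pos (show 0 < x - lower c β t by linarith) (sub_pos.2 H),
      mul_nonneg (sub_nonneg.2 H') (show 0 ≤ upper c β x - t by linarith)]
  · rintro ⟨H1, H2⟩
    by_contra! H'
    have h3 : lower c β x ≤ x := (lower_le_max hc0 hc1 hβ hx.le).trans (max_le le_rfl H2.le)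
    have h4 : lower c β t ≤ x :=
      (lower_le_max hc0 hc1 hβ ht.le).trans (max_le (by linarith) H2.le)
    nlinarith [mul_pos (sub_pos.2 H1) (show 0 < upper c β x - t by linarith),
      mul_nonneg (sub_nonneg.2 h4) (sub_nonneg.2 H')]

/-- The counterpart to the left of `base`. The conclusion has the shape of the hypotheses with `x`
and `t` exchanged, so the lemma is its own converse. -/
theorem lt_lower_of_lt_base (hc0 : 0 < c) (hc1 : c < 1) (hβ : 0 ≤ β) {x t : ℝ} (hx : 0 < x)
    (ht : 0 < t) (hxb : x < base c β) (h : t < lower c β x) :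
    x < lower c β t ∧ t < base c β := by
  have hd := duality hc0 hc1 hβ hx.le ht.le
  have hx1 := lower_lt_upper hc0 hc1 hβ hx
  have ht3 := base_lt_upper hc0 hc1 hβ ht
  have h2 : lower c β x ≤ base c β := (lower_le_max hc0 hc1 hβ hx.le).trans (max_le hxb.le le_rfl)
  refine ⟨?_, by linarith⟩
  by_contra! H
  nlinarith [mul_pos (sub_pos.2 h) (show 0 < upper c β x - t by linarith),
    mul_nonneg (sub_nonneg.2 H) (show 0 ≤ upper c β t - x by linarith)]

theorem lt_base_of_lt_lower (hc0 : 0 < c) (hc1 : c < 1) (hβ : 0 ≤ β) {x t : ℝ}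
    (ht : 0 < t) (hxt : x < lower c β t) (htb : t < base c β) : x < base c β :=
  hxt.trans_le ((lower_le_max hc0 hc1 hβ ht.le).trans (max_le htb.le le_rfl))

theorem density_symm (hc0 : 0 < c) (hc1 : c < 1) (hβ : 0 ≤ β) {x t : ℝ} (hx : 0 ≤ x)
    (ht : 0 ≤ t) : ArcsineLaw.density (lower c β t) (upper c β t) x
      = ArcsineLaw.density (lower c β x) (upper c β x) t := by
  rw [ArcsineLaw.density, duality hc0 hc1 hβ hx ht, ArcsineLaw.density]

theorem exterior_symm (hc0 : 0 < c) (hc1 : c < 1) (hβ : 0 ≤ β) {x t : ℝ} (hx : 0 ≤ x)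
    (ht : 0 ≤ t) : (x - lower c β t) * (x - upper c β t)
      = (lower c β x - t) * (upper c β x - t) := by
  linear_combination -duality hc0 hc1 hβ hx ht

theorem hasDerivAt_pot (hβ : 0 ≤ β) {x : ℝ} (hx : 0 < x) :
    HasDerivAt (pot c β) (-log c + log x - log (x + β)) x := by
  have h1 := hasDerivAt_mul_log hx.ne'
  have h2 : HasDerivAt (fun x => (x + β) * log (x + β)) (log (x + β) + 1) x := by
    have := (hasDerivAt_mul_log (x := x + β) (by positivity)).comp_add_const x β
    simpa using this
  have h3 := (((hasDerivAt_id x).neg.mul_const (log c)).add_const β).add h1 |>.sub h2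
  refine (h3.congr_deriv ?_)
  ring

/-- With `r = √(c (y + β))` and `p = √y`, the square roots of the endpoints are `(r + p)` and `|r -
p|` over `√(1 - c)`. Their sum is twice the maximum of `r` and `p`, so the left side is `|log r -
log p|`. The right side is half of `|pot'(y)|`. -/
theorem log_sqrt_lower_upper (hc0 : 0 < c) (hc1 : c < 1) (hβ : 0 ≤ β) {y : ℝ} (hy : 0 < y) :
    2 * log ((√(upper c β y - 0) + √(lower c β y - 0)) / √(upper c β y - lower c β y))
      = |-log c + log y - log (y + β)| / 2 := by
  have hd : 0 < 1 - c := by linarith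
  have hr : 0 < √(c * (y + β)) := by positivity
  have hp : 0 < √y := by positivity
  have lr : log √(c * (y + β)) = (log c + log (y + β)) / 2 := by
    rw [log_sqrt (by positivity), log_mul hc0.ne' (by positivity)]
  have lp : log √y = log y / 2 := log_sqrt hy.le
  rw [upper_sub_lower hc1]
  have hu : √(upper c β y) = (√(c * (y + β)) + √y) / √(1 - c) := by
    rw [upper, sqrt_div (by positivity), sqrt_sq (by positivity)]
  have hl : √(lower c β y) = |√(c * (y + β)) - √y| / √(1 - c) := by
    rw [lower, sqrt_div (by positivity), sqrt_sq_eq_abs]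
  have hdd : √(4 * (√(c * (y + β)) * √y) / (1 - c))
      = 2 * √(√(c * (y + β)) * √y) / √(1 - c) := by
    rw [sqrt_div (by positivity), sqrt_mul (by norm_num)]
    norm_num
  have lq : log √(√(c * (y + β)) * √y) = ((log c + log (y + β)) / 2 + log y / 2) / 2 := by
    rw [log_sqrt (by positivity), log_mul hr.ne' hp.ne', lr, lp]
  rw [sub_zero, sub_zero, hu, hl, hdd]
  have hk : 0 < √(1 - c) := sqrt_pos.2 hd
  rcases le_total √(c * (y + β)) √y with H | H
  · have hle := log_le_log hr H
    rw [lr, lp] at hle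
    rw [abs_of_nonpos (by linarith), abs_of_nonneg (by linarith),
      show ((√(c * (y + β)) + √y) / √(1 - c) + -(√(c * (y + β)) - √y) / √(1 - c)) /
        (2 * √(√(c * (y + β)) * √y) / √(1 - c)) = √y / √(√(c * (y + β)) * √y) by
          field_simp; ring,
      log_div hp.ne' (by positivity), lq, lp]
    ring
  · have hle := log_le_log hp H
    rw [lr, lp] at hle
    rw [abs_of_nonneg (by linarith), abs_of_nonpos (by linarith),
      show ((√(c * (y + β)) + √y) / √(1 - c) + (√(c * (y + β)) - √y) / √(1 - c)) /
        (2 * √(√(c * (y + β)) * √y) / √(1 - c)) = √(c * (y + β)) / √(√(c * (y + β)) * √y) by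
          field_simp; ring,
      log_div hr.ne' (by positivity), lq, lr]
    ring

theorem log_le_of_base_le (hc0 : 0 < c) (hc1 : c < 1) (hβ : 0 ≤ β) {y : ℝ} (hy : 0 < y)
    (h : base c β ≤ y) : 0 ≤ -log c + log y - log (y + β) := by
  rw [base, div_le_iff₀ (by linarith)] at h
  have := log_le_log (by positivity) (show c * (y + β) ≤ y by linarith)
  rw [log_mul hc0.ne' (by positivity)] at this
  linarith

theorem log_le_of_le_base (hc0 : 0 < c) (hc1 : c < 1) (hβ : 0 ≤ β) {y : ℝ} (hy : 0 < y)
    (h : y ≤ base c β) : -log c + log y - log (y + β) ≤ 0 := by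
  rw [base, le_div_iff₀ (by linarith)] at h
  have := log_le_log (by positivity) (show y ≤ c * (y + β) by linarith)
  rw [log_mul hc0.ne' (by positivity)] at this
  linarith

/-- The Green function of the support at time `t`. -/
noncomputable def green (c β t x : ℝ) : ℝ := ArcsineLaw.green (lower c β t) (upper c β t) x

theorem measurable_green : Measurable fun p : ℝ × ℝ => green c β p.1 p.2 := by
  unfold green ArcsineLaw.green
  refine Measurable.ite ?_ measurable_const (by fun_prop)
  exact (measurableSet_le (f := fun p : ℝ × ℝ => lower c β p.1) (by fun_prop) (by fun_prop)).inter
    (measurableSet_le (g := fun p : ℝ × ℝ => upper c β p.1) (by fun_prop) (by fun_prop))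

/-- By duality the integrand is, in `t`, the derivative up to sign of the Green function of `[lower
y, upper y]`; integrating over `(0, lower y)` gives that Green function at `0`, which is half of
`|pot'(y)|`. -/
theorem lintegral_time_exterior (hc0 : 0 < c) (hc1 : c < 1) (hβ : 0 ≤ β) {y : ℝ} (hy : 0 < y) :
    ∫⁻ t in Ioo 0 (lower c β y),
        ENNReal.ofReal (√((y - lower c β t) * (y - upper c β t)))⁻¹
      = ENNReal.ofReal (|-log c + log y - log (y + β)| / 2) := by
  rw [← log_sqrt_lower_upper hc0 hc1 hβ hy,
    ← ArcsineLaw.lintegral_inv_sqrt_of_ge (lower_lt_upper hc0 hc1 hβ hy) (lower_nonneg hc1 y)]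
  refine setLIntegral_congr_fun measurableSet_Ioo fun t ht => ?_
  rw [exterior_symm hc0 hc1 hβ hy.le ht.1.le]

/-- Each Green function is a space integral from the edge of its support to `x`. After exchanging
space and time, the inner time integral is half of `|pot'|`, and the outer one runs between `base`
and `x`, where `pot'` has constant sign. The two sides of `base` are mirror images. -/
theorem pot_base_le_and_lintegral_green (hc0 : 0 < c) (hc1 : c < 1) (hβ : 0 ≤ β) {x : ℝ}
    (hx : 0 < x) : pot c β (base c β) ≤ pot c β x ∧
      ∫⁻ t in Ioo 0 (lower c β x), ENNReal.ofReal (green c β t x)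
        = ENNReal.ofReal ((pot c β x - pot c β (base c β)) / 2) := by
  have hme : Measurable (Function.uncurry fun t y : ℝ =>
      ENNReal.ofReal (√((y - lower c β t) * (y - upper c β t)))⁻¹) := by
    unfold Function.uncurry
    fun_prop
  have hb := base_nonneg hc0 hc1 hβ
  rcases lt_trichotomy (base c β) x with hbx | hbx | hbx
  · have hd : ∀ y ∈ Ioo (base c β) x,
        HasDerivAt (fun y => pot c β y / 2) ((-log c + log y - log (y + β)) / 2) y :=
      fun y hy => (hasDerivAt_pot hβ (hb.trans_lt hy.1)).div_const 2
    have hp : ∀ y ∈ Ioo (base c β) x, 0 ≤ (-log c + log y - log (y + β)) / 2 := fun y hy => by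
      have := log_le_of_base_le hc0 hc1 hβ (hb.trans_lt hy.1) hy.1.le
      positivity
    have hcont : ContinuousOn (fun y => pot c β y / 2) (Icc (base c β) x) := by fun_prop
    refine ⟨by linarith [le_of_hasDerivAt_nonneg hbx.le hcont hd hp], ?_⟩
    rw [sub_div, ← lintegral_Ioo_deriv_of_nonneg hbx.le hcont hd hp]
    calc _ = ∫⁻ t in Ioo 0 (lower c β x), ∫⁻ y in Ioo (upper c β t) x,
          ENNReal.ofReal (√((y - lower c β t) * (y - upper c β t)))⁻¹ := by
          refine setLIntegral_congr_fun measurableSet_Ioo fun t ht => ?_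
          have h1 := (upper_lt_iff hc0 hc1 hβ hx ht.1).2 ⟨ht.2, hbx⟩
          have h2 := lower_lt_upper hc0 hc1 hβ ht.1
          rw [green, ArcsineLaw.green_of_lt h2 h1, ArcsineLaw.lintegral_inv_sqrt_of_le h2 h1.le]
      _ = ∫⁻ y in Ioo (base c β) x, ∫⁻ t in Ioo 0 (lower c β y),
          ENNReal.ofReal (√((y - lower c β t) * (y - upper c β t)))⁻¹ := by
          refine lintegral_lintegral_swap_of_mem_iff measurableSet_Ioo measurableSet_Ioo
            (fun _ => measurableSet_Ioo) (fun _ => measurableSet_Ioo) ?_ hme ?_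
          · exact (measurableSet_Ioo.preimage measurable_fst).inter
              ((measurableSet_lt (f := fun p : ℝ × ℝ => upper c β p.1) (by fun_prop)
                measurable_snd).inter (measurableSet_lt measurable_snd measurable_const))
          · intro t y
            constructor
            · rintro ⟨ht, hy⟩
              have hby := (base_lt_upper hc0 hc1 hβ ht.1).trans hy.1
              exact ⟨⟨hby, hy.2⟩, ht.1,
                ((upper_lt_iff hc0 hc1 hβ (hb.trans_lt hby) ht.1).1 hy.1).1⟩
            · rintro ⟨hy, ht⟩
              have h1 := (upper_lt_iff hc0 hc1 hβ (hb.trans_lt hy.1) ht.1).2 ⟨ht.2, hy.1⟩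
              exact ⟨⟨ht.1, ((upper_lt_iff hc0 hc1 hβ hx ht.1).1 (h1.trans hy.2)).1⟩, h1, hy.2⟩
      _ = _ := by
          refine setLIntegral_congr_fun measurableSet_Ioo fun y hy => ?_
          rw [lintegral_time_exterior hc0 hc1 hβ (hb.trans_lt hy.1), abs_of_nonneg]
          linarith [hp y hy]
  · refine ⟨by rw [hbx], ?_⟩
    -- At `x = base` one has `c (x + β) = x`, so the range of times is empty.
    have : lower c β x = 0 := by
      have hd : 1 - c ≠ 0 := by linarith
      have : c * (x + β) = x := by
        rw [← hbx, base]; field_simp; ring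
      rw [lower, this]
      simp
    simp [this, hbx]
  · have hd : ∀ y ∈ Ioo x (base c β),
        HasDerivAt (fun y => -(pot c β y / 2)) (-((-log c + log y - log (y + β)) / 2)) y :=
      fun y hy => ((hasDerivAt_pot hβ (hx.trans hy.1)).div_const 2).neg
    have hp : ∀ y ∈ Ioo x (base c β), 0 ≤ -((-log c + log y - log (y + β)) / 2) := fun y hy => by
      have := log_le_of_le_base hc0 hc1 hβ (hx.trans hy.1) hy.2.le
      linarith
    have hcont : ContinuousOn (fun y => -(pot c β y / 2)) (Icc x (base c β)) := by fun_prop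
    refine ⟨by linarith [le_of_hasDerivAt_nonneg hbx.le hcont hd hp], ?_⟩
    rw [show (pot c β x - pot c β (base c β)) / 2
      = -(pot c β (base c β) / 2) - -(pot c β x / 2) by ring,
      ← lintegral_Ioo_deriv_of_nonneg hbx.le hcont hd hp]
    calc _ = ∫⁻ t in Ioo 0 (lower c β x), ∫⁻ y in Ioo x (lower c β t),
          ENNReal.ofReal (√((y - lower c β t) * (y - upper c β t)))⁻¹ := by
          refine setLIntegral_congr_fun measurableSet_Ioo fun t ht => ?_
          have h1 := lt_lower_of_lt_base hc0 hc1 hβ hx ht.1 hbx ht.2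
          have h2 := lower_lt_upper hc0 hc1 hβ ht.1
          rw [green, ArcsineLaw.green_of_gt h2 h1.1, ← ArcsineLaw.lintegral_inv_sqrt_of_ge h2 h1.1.le]
          refine lintegral_congr fun y => ?_
          congr 3
          ring
      _ = ∫⁻ y in Ioo x (base c β), ∫⁻ t in Ioo 0 (lower c β y),
          ENNReal.ofReal (√((y - lower c β t) * (y - upper c β t)))⁻¹ := by
          refine lintegral_lintegral_swap_of_mem_iff measurableSet_Ioo measurableSet_Ioo
            (fun _ => measurableSet_Ioo) (fun _ => measurableSet_Ioo) ?_ hme ?_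
          · exact (measurableSet_Ioo.preimage measurable_fst).inter
              ((measurableSet_lt measurable_const measurable_snd).inter
                (measurableSet_lt (g := fun p : ℝ × ℝ => lower c β p.1) measurable_snd
                  (by fun_prop)))
          · intro t y
            constructor
            · rintro ⟨ht, hy⟩
              have h1 := lt_lower_of_lt_base hc0 hc1 hβ hx ht.1 hbx ht.2
              have hy0 : 0 < y := hx.trans hy.1
              have hyb := lt_base_of_lt_lower hc0 hc1 hβ ht.1 hy.2 h1.2
              exact ⟨⟨hy.1, hyb⟩, ht.1, (lt_lower_of_lt_base hc0 hc1 hβ ht.1 hy0 h1.2 hy.2).1⟩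
            · rintro ⟨hy, ht⟩
              have hy0 : 0 < y := hx.trans hy.1
              have h1 := lt_lower_of_lt_base hc0 hc1 hβ hy0 ht.1 hy.2 ht.2
              exact ⟨⟨ht.1, (lt_lower_of_lt_base hc0 hc1 hβ ht.1 hx h1.2 (hy.1.trans h1.1)).1⟩,
                hy.1, h1.1⟩
      _ = _ := by
          refine setLIntegral_congr_fun measurableSet_Ioo fun y hy => ?_
          rw [lintegral_time_exterior hc0 hc1 hβ (hx.trans hy.1), abs_of_nonpos, neg_div]
          linarith [hp y hy]

end Meixner

/-! ### The logarithmic kernel: integrability and conditional negative definiteness. -/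

namespace LogKernel

open Real Set Filter Topology

/-- The singular part of the logarithm, cut off at distance one. -/
noncomputable def sing (u : ℝ) : ℝ := (Ioo (-1) 1).indicator (fun u => |log u|) u

theorem sing_nonneg (u : ℝ) : 0 ≤ sing u := indicator_nonneg (fun _ _ => abs_nonneg _) u

theorem integrable_sing : Integrable sing := by
  unfold sing
  rw [integrable_indicator_iff measurableSet_Ioo]
  have h := (intervalIntegral.intervalIntegrable_log' (a := -1) (b := 1)).abs
  rw [intervalIntegrable_iff_integrableOn_Ioo_of_le (by norm_num)] at h
  exact h

theorem abs_log_le (u : ℝ) : |log u| ≤ sing u + |u| := by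
  by_cases hu : u ∈ Ioo (-1 : ℝ) 1
  · rw [sing, indicator_of_mem hu]
    linarith [abs_nonneg u]
  · rw [sing, indicator_of_notMem hu, zero_add]
    have h1 : 1 ≤ |u| := by
      by_contra! H
      exact hu (abs_lt.1 H)
    rw [← log_abs, abs_of_nonneg (log_nonneg h1)]
    exact log_le_self (by linarith)

theorem integrable_mul_log_sub {g : ℝ → ℝ} (hg : Integrable g) (hg1 : ∀ᵐ x, |g x| ≤ 1)
    (hgx : Integrable fun x => x * g x) (x : ℝ) : Integrable fun y => g y * log (x - y) := by
  have h1 : Integrable fun y => sing (x - y) := integrable_sing.comp_sub_left x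
  refine Integrable.mono' ((h1.add (hg.abs.const_mul |x|)).add hgx.abs)
    (hg.1.mul (measurable_log.comp (by fun_prop)).aestronglyMeasurable) ?_
  filter_upwards [hg1] with y hy
  simp only [Pi.add_apply, norm_mul, norm_eq_abs, abs_mul]
  have h2 := abs_log_le (x - y)
  have h3 := sing_nonneg (x - y)
  have h4 := abs_sub x y
  have h0 := abs_nonneg (g y)
  calc |g y| * |log (x - y)| ≤ |g y| * (sing (x - y) + (|x| + |y|)) := by gcongr; linarith
    _ ≤ _ := by nlinarith

/-- Near the diagonal the bound on `g` leaves a convolution integrand of the integrable functions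
`|f|` and `sing`; the linear growth of the logarithm is absorbed by the first moments. -/
theorem integrable_mul_mul_log_sub {f g : ℝ → ℝ} (hf : Integrable f) (hg : Integrable g)
    (hg1 : ∀ᵐ x, |g x| ≤ 1) (hfx : Integrable fun x => x * f x)
    (hgx : Integrable fun x => x * g x) :
    Integrable (fun p : ℝ × ℝ => f p.1 * g p.2 * log (p.1 - p.2)) (volume.prod volume) := by
  have h1 : Integrable (fun p : ℝ × ℝ => |f p.1| * sing (p.1 - p.2)) (volume.prod volume) := by
    have := (hf.abs.convolution_integrand (ContinuousLinearMap.mul ℝ ℝ)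
      (integrable_sing.comp_neg)).swap
    refine this.congr (Eventually.of_forall fun p => ?_)
    simp
  have h2 : Integrable (fun p : ℝ × ℝ => (p.1 * f p.1) * g p.2) (volume.prod volume) :=
    hfx.mul_prod hg
  have h3 : Integrable (fun p : ℝ × ℝ => f p.1 * (p.2 * g p.2)) (volume.prod volume) :=
    hf.mul_prod hgx
  refine Integrable.mono' ((h1.add h2.abs).add h3.abs)
    ((hf.1.comp_fst.mul hg.1.comp_snd).mul
      (measurable_log.comp (by fun_prop)).aestronglyMeasurable) ?_
  have hg2 : ∀ᵐ p : ℝ × ℝ ∂(volume.prod volume), |g p.2| ≤ 1 :=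
    Measure.quasiMeasurePreserving_snd.ae hg1
  filter_upwards [hg2] with p hp
  simp only [Pi.add_apply, norm_mul, norm_eq_abs, abs_mul]
  have h2 := abs_log_le (p.1 - p.2)
  have h3 := sing_nonneg (p.1 - p.2)
  have h4 := abs_sub p.1 p.2
  have h0 := abs_nonneg (g p.2)
  calc |f p.1| * |g p.2| * |log (p.1 - p.2)|
      ≤ |f p.1| * |g p.2| * (sing (p.1 - p.2) + (|p.1| + |p.2|)) := by gcongr; linarith
    _ = |f p.1| * (|g p.2| * sing (p.1 - p.2)) + |p.1| * |f p.1| * |g p.2|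
        + |f p.1| * (|p.2| * |g p.2|) := by ring
    _ ≤ _ := by
      gcongr
      nlinarith

theorem abs_frullani_le {d t : ℝ} (ht : 0 < t) :
    |t⁻¹ * (exp (-(d * t)) - exp (-(1 * t)))| ≤ |1 - d| * exp (-(min d 1) * t) := by
  have key : ∀ a b : ℝ, a ≤ b → 0 ≤ exp (-(a * t)) - exp (-(b * t)) ∧
      t⁻¹ * (exp (-(a * t)) - exp (-(b * t))) ≤ (b - a) * exp (-a * t) := by
    intro a b hab
    refine ⟨sub_nonneg.2 (exp_le_exp.2 (by nlinarith)), ?_⟩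
    rw [inv_mul_le_iff₀ ht]
    have h1 : exp (-(b * t)) = exp (-(a * t)) * exp (-((b - a) * t)) := by
      rw [← exp_add]; ring_nf
    have h2 := add_one_le_exp (-((b - a) * t))
    rw [h1, neg_mul]
    nlinarith [exp_pos (-(a * t))]
  rw [abs_mul, abs_of_pos (inv_pos.2 ht)]
  rcases le_total d 1 with h | h
  · obtain ⟨h1, h2⟩ := key d 1 h
    rw [abs_of_nonneg h1, abs_of_nonneg (sub_nonneg.2 h), min_eq_left h]
    exact h2
  · obtain ⟨h1, h2⟩ := key 1 d h
    rw [abs_sub_comm, abs_of_nonneg h1, abs_sub_comm, abs_of_nonneg (sub_nonneg.2 h),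
      min_eq_right h]
    exact h2

theorem integrableOn_frullani {d : ℝ} (hd : 0 < d) :
    IntegrableOn (fun t => t⁻¹ * (exp (-(d * t)) - exp (-(1 * t)))) (Ioi 0) := by
  have hm : 0 < min d 1 := lt_min hd one_pos
  have h1 : IntegrableOn (fun t => |1 - d| * exp (-(min d 1) * t)) (Ioi 0) :=
    (integrableOn_exp_mul_Ioi (by linarith) 0).const_mul _
  refine Integrable.mono' h1 (Measurable.aestronglyMeasurable (by fun_prop)) ?_
  exact (ae_restrict_mem measurableSet_Ioi).mono fun t ht => abs_frullani_le ht

/-- This writes `-log d` as a superposition of the kernels `exp (-(d * t))`, up to a term that does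
not depend on `d`. -/
theorem integral_frullani {d : ℝ} (hd : 0 < d) :
    ∫ t in Ioi (0 : ℝ), t⁻¹ * (exp (-(d * t)) - exp (-(1 * t))) = -log d := by
  have := Frullani.integral_Ioi_eq (f := fun x : ℝ => exp (-x)) (a := d) (b := 1) (L := 1) (R := 0)
    ((by fun_prop : Continuous fun x : ℝ => exp (-x)).locallyIntegrable.locallyIntegrableOn _) hd one_pos
    ?_ (tendsto_exp_neg_atTop_nhds_zero) (by simpa using integrableOn_frullani hd)
  · simpa using this
  · have : Tendsto (fun x : ℝ => exp (-x)) (𝓝 0) (𝓝 (exp (-0))) :=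
      Continuous.tendsto (by fun_prop) 0
    simp only [neg_zero, exp_zero] at this
    exact this.mono_left nhdsWithin_le_nhds

theorem integral_abs_frullani {d : ℝ} (hd : 0 < d) :
    ∫ t in Ioi (0 : ℝ), |t⁻¹ * (exp (-(d * t)) - exp (-(1 * t)))| = |log d| := by
  rcases le_total d 1 with h | h
  · rw [abs_of_nonpos (log_nonpos hd.le h), ← integral_frullani hd]
    refine setIntegral_congr_fun measurableSet_Ioi fun t ht => abs_of_nonneg ?_
    have ht : 0 < t := ht
    exact mul_nonneg (by positivity) (sub_nonneg.2 (exp_le_exp.2 (by nlinarith)))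
  · rw [abs_of_nonneg (log_nonneg h), ← neg_neg (log d), ← integral_frullani hd, ← integral_neg]
    refine setIntegral_congr_fun measurableSet_Ioi fun t ht => abs_of_nonpos ?_
    have ht : 0 < t := ht
    exact mul_nonpos_of_nonneg_of_nonpos (by positivity)
      (sub_nonpos.2 (exp_le_exp.2 (by nlinarith)))

/-- The kernel `exp (-t|x - y|)` is, up to a factor, an inner product of one-sided exponentials
attached to `x` and to `y`; this is its positive definiteness. -/
theorem integral_exp_layer {t : ℝ} (ht : 0 < t) (x y : ℝ) :
    Integrable (fun u => (Iio x).indicator (fun u => exp (-(t * (x - u)))) u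
        * (Iio y).indicator (fun u => exp (-(t * (y - u)))) u) ∧
      ∫ u, (Iio x).indicator (fun u => exp (-(t * (x - u)))) u
        * (Iio y).indicator (fun u => exp (-(t * (y - u)))) u
      = exp (-(t * |x - y|)) / (2 * t) := by
  have h1 : (fun u => (Iio x).indicator (fun u => exp (-(t * (x - u)))) u
        * (Iio y).indicator (fun u => exp (-(t * (y - u)))) u)
      = (Iio (min x y)).indicator fun u => exp (-(t * (x + y))) * exp (2 * t * u) := by
    ext u
    by_cases hx : u < x <;> by_cases hy : u < y <;> simp [indicator, hx, hy]
    rw [← exp_add, ← exp_add]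
    ring_nf
  rw [h1, integrable_indicator_iff measurableSet_Iio, integral_indicator measurableSet_Iio,
    integral_const_mul, ← integral_Iic_eq_integral_Iio, integral_exp_mul_Iic (by positivity)]
  refine ⟨((integrableOn_exp_mul_Iic (by positivity) _).mono_set
    Iio_subset_Iic_self).const_mul _, ?_⟩
  rw [← mul_div_assoc, ← exp_add]
  congr 2
  rcases le_total x y with h | h
  · rw [min_eq_left h, abs_of_nonpos (by linarith)]; ring
  · rw [min_eq_right h, abs_of_nonneg (by linarith)]; ring

/-- By Fubini the form is `2t` times the integral over `u` of the square of `∫ f(x) h(x, u) dx`. -/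
theorem integral_mul_exp_nonneg {f : ℝ → ℝ} (hf : Integrable f) {t : ℝ} (ht : 0 < t) :
    0 ≤ ∫ p : ℝ × ℝ, f p.1 * f p.2 * exp (-(t * |p.1 - p.2|)) ∂(volume.prod volume) := by
  set h : ℝ → ℝ → ℝ := fun x u => (Iio x).indicator (fun u => exp (-(t * (x - u)))) u with hh
  have hmeas : Measurable (Function.uncurry h) := by
    have : Function.uncurry h
        = {q : ℝ × ℝ | q.2 < q.1}.indicator fun q => exp (-(t * (q.1 - q.2))) := by
      ext q; simp [h, Function.uncurry, indicator]
    rw [this]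
    exact Measurable.indicator (by fun_prop) (measurableSet_lt measurable_snd measurable_fst)
  have h0 : ∀ x u, 0 ≤ h x u := fun x u => indicator_nonneg (fun _ _ => (exp_pos _).le) u
  set F : ℝ × ℝ → ℝ → ℝ := fun p u => f p.1 * f p.2 * (h p.1 u * h p.2 u) with hF
  have hff : Integrable (fun p : ℝ × ℝ => f p.1 * f p.2) (volume.prod volume) := hf.mul_prod hf
  have hE : ∀ p : ℝ × ℝ, ∫ u, F p u = f p.1 * f p.2 * exp (-(t * |p.1 - p.2|)) / (2 * t) := by
    intro p
    rw [hF, integral_const_mul, (integral_exp_layer ht p.1 p.2).2, mul_div_assoc]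
  have hint : Integrable (Function.uncurry F) ((volume.prod volume).prod volume) := by
    rw [integrable_prod_iff]
    · refine ⟨Eventually.of_forall fun p =>
        (integral_exp_layer ht p.1 p.2).1.const_mul (f p.1 * f p.2), ?_⟩
      have : ∀ p : ℝ × ℝ, ∫ u, ‖Function.uncurry F (p, u)‖
          = |f p.1 * f p.2| * (exp (-(t * |p.1 - p.2|)) / (2 * t)) := by
        intro p
        rw [← (integral_exp_layer ht p.1 p.2).2, ← integral_const_mul]
        refine integral_congr_ae (Eventually.of_forall fun u => ?_)
        simp only [Function.uncurry, hF, norm_mul, norm_eq_abs, abs_mul]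
        rw [abs_of_nonneg (h0 _ _), abs_of_nonneg (h0 _ _)]
      simp_rw [this]
      refine Integrable.mono' (hff.abs.mul_const (1 / (2 * t)))
        (hff.1.norm.mul (by fun_prop)) (Eventually.of_forall fun p => ?_)
      rw [norm_mul, norm_eq_abs, abs_abs, norm_of_nonneg (by positivity)]
      gcongr
      rw [exp_le_one_iff]
      have := abs_nonneg (p.1 - p.2)
      nlinarith
    · have m1 : Measurable fun q : (ℝ × ℝ) × ℝ => h q.1.1 q.2 * h q.1.2 q.2 :=
        (hmeas.comp (by fun_prop : Measurable fun q : (ℝ × ℝ) × ℝ => (q.1.1, q.2))).mul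
          (hmeas.comp (by fun_prop : Measurable fun q : (ℝ × ℝ) × ℝ => (q.1.2, q.2)))
      exact hff.1.comp_fst.mul m1.aestronglyMeasurable
  have key := integral_integral_swap hint
  simp_rw [hE] at key
  rw [integral_div, div_eq_iff (by positivity)] at key
  rw [key]
  refine mul_nonneg (integral_nonneg fun u => ?_) (by positivity)
  have : ∫ p : ℝ × ℝ, F p u ∂(volume.prod volume) = (∫ x, f x * h x u) * ∫ x, f x * h x u := by
    rw [← integral_prod_mul]
    refine integral_congr_ae (Eventually.of_forall fun p => ?_)
    simp only [hF]
    ring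
  simp only [this]
  exact mul_self_nonneg _

theorem ae_prod_ne : ∀ᵐ p : ℝ × ℝ ∂(volume.prod volume), p.1 ≠ p.2 := by
  rw [Measure.ae_prod_iff_ae_ae]
  · refine Eventually.of_forall fun x => ?_
    filter_upwards [(countable_singleton x).ae_notMem volume] with y hy
    exact fun H => hy H.symm
  · exact (measurableSet_eq_fun measurable_fst measurable_snd).compl

/-- The logarithmic kernel is conditionally negative definite. -/
theorem integral_mul_log_nonpos {f : ℝ → ℝ} (hf : Integrable f) (hf1 : ∀ᵐ x, |f x| ≤ 1)
    (hfx : Integrable fun x => x * f x) (hf0 : ∫ x, f x = 0) :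
    ∫ p : ℝ × ℝ, f p.1 * f p.2 * log (p.1 - p.2) ∂(volume.prod volume) ≤ 0 := by
  have hlog := integrable_mul_mul_log_sub hf hf hf1 hfx hfx
  have hff : Integrable (fun p : ℝ × ℝ => f p.1 * f p.2) (volume.prod volume) := hf.mul_prod hf
  have hne : ∀ᵐ p : ℝ × ℝ ∂(volume.prod volume), p.1 - p.2 ≠ 0 :=
    ae_prod_ne.mono fun p hp => sub_ne_zero.2 hp
  set F : ℝ × ℝ → ℝ → ℝ := fun p t =>
    f p.1 * f p.2 * (t⁻¹ * (exp (-(|p.1 - p.2| * t)) - exp (-(1 * t)))) with hF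
  have hint : Integrable (Function.uncurry F)
      ((volume.prod volume).prod (volume.restrict (Ioi 0))) := by
    rw [integrable_prod_iff]
    · refine ⟨hne.mono fun p hp =>
        Integrable.const_mul (integrableOn_frullani (abs_pos.2 hp)) (f p.1 * f p.2), ?_⟩
      refine hlog.abs.congr (hne.mono fun p hp => ?_)
      simp only [Function.uncurry, hF, norm_mul, norm_eq_abs, abs_mul]
      rw [integral_const_mul, ← log_abs (p.1 - p.2), ← integral_abs_frullani (abs_pos.2 hp)]
      simp only [abs_mul]
    · exact hff.1.comp_fst.mul (Measurable.aestronglyMeasurable (by fun_prop))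
  have key := integral_integral_swap hint
  have h1 : ∫ p : ℝ × ℝ, (∫ t in Ioi 0, F p t) ∂(volume.prod volume)
      = -∫ p : ℝ × ℝ, f p.1 * f p.2 * log (p.1 - p.2) ∂(volume.prod volume) := by
    rw [← integral_neg]
    refine integral_congr_ae (hne.mono fun p hp => ?_)
    simp only [hF]
    rw [integral_const_mul, integral_frullani (abs_pos.2 hp), log_abs]
    ring
  have h2 : 0 ≤ ∫ t in Ioi (0 : ℝ), ∫ p : ℝ × ℝ, F p t ∂(volume.prod volume) := by
    refine setIntegral_nonneg measurableSet_Ioi fun t ht => ?_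
    have ht : 0 < t := ht
    have e1 : ∫ p : ℝ × ℝ, F p t ∂(volume.prod volume)
        = t⁻¹ * (∫ p : ℝ × ℝ, f p.1 * f p.2 * exp (-(t * |p.1 - p.2|)) ∂(volume.prod volume))
          - t⁻¹ * exp (-t) * ∫ p : ℝ × ℝ, f p.1 * f p.2 ∂(volume.prod volume) := by
      rw [← integral_const_mul, ← integral_const_mul, ← integral_sub]
      · refine integral_congr_ae (Eventually.of_forall fun p => ?_)
        simp only [hF]
        rw [mul_comm t, one_mul]
        ring
      · refine Integrable.const_mul ?_ _
        refine Integrable.mono' hff.abs (hff.1.mul (by fun_prop)) (Eventually.of_forall fun p => ?_)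
        rw [norm_mul, norm_eq_abs, norm_of_nonneg (exp_pos _).le]
        refine mul_le_of_le_one_right (abs_nonneg _) ?_
        rw [exp_le_one_iff]
        have := abs_nonneg (p.1 - p.2)
        nlinarith
      · exact hff.const_mul _
    -- The term `exp (-t)`, which makes the Frullani integral converge at `t = 0`, drops out because
    -- `f` has integral zero.
    have e2 : ∫ p : ℝ × ℝ, f p.1 * f p.2 ∂(volume.prod volume) = 0 := by
      rw [integral_prod_mul, hf0, zero_mul]
    rw [e1, e2, mul_zero, sub_zero]
    exact mul_nonneg (by positivity) (integral_mul_exp_nonneg hf ht)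
  linarith

end LogKernel

/-! ### Integration against real densities and their products. -/

namespace MeasureTheory

variable {X : Type*} [MeasurableSpace X] {μ : Measure X} {f : X → ℝ}

theorem integrable_withDensity_ofReal_iff (hf : AEMeasurable f μ) (h0 : ∀ᵐ x ∂μ, 0 ≤ f x)
    {g : X → ℝ} : Integrable g (μ.withDensity fun x => ENNReal.ofReal (f x))
      ↔ Integrable (fun x => f x * g x) μ := by
  rw [integrable_withDensity_iff_integrable_smul₀' hf.ennreal_ofReal (by simp)]
  refine integrable_congr (h0.mono fun x hx => ?_)
  simp only [ENNReal.toReal_ofReal hx, smul_eq_mul]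

theorem integral_withDensity_ofReal (hf : AEMeasurable f μ) (h0 : ∀ᵐ x ∂μ, 0 ≤ f x)
    (g : X → ℝ) : ∫ x, g x ∂(μ.withDensity fun x => ENNReal.ofReal (f x))
      = ∫ x, f x * g x ∂μ := by
  rw [integral_withDensity_eq_integral_toReal_smul₀ hf.ennreal_ofReal (by simp)]
  refine integral_congr_ae (h0.mono fun x hx => ?_)
  simp only [ENNReal.toReal_ofReal hx, smul_eq_mul]

theorem withDensity_ofReal_prod [SFinite μ] (hf : AEMeasurable f μ) (h0 : ∀ᵐ x ∂μ, 0 ≤ f x) :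
    (μ.withDensity fun x => ENNReal.ofReal (f x)).prod (μ.withDensity fun x => ENNReal.ofReal (f x))
      = (μ.prod μ).withDensity fun p => ENNReal.ofReal (f p.1 * f p.2) := by
  rw [prod_withDensity₀ hf.ennreal_ofReal hf.ennreal_ofReal]
  have h1 : ∀ᵐ p : X × X ∂(μ.prod μ), 0 ≤ f p.1 := Measure.quasiMeasurePreserving_fst.ae h0
  exact withDensity_congr_ae (h1.mono fun p hp => (ENNReal.ofReal_mul hp).symm)

theorem ae_nonneg_mul_prod [SFinite μ] (h0 : ∀ᵐ x ∂μ, 0 ≤ f x) :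
    ∀ᵐ p : X × X ∂(μ.prod μ), 0 ≤ f p.1 * f p.2 := by
  have h1 : ∀ᵐ p : X × X ∂(μ.prod μ), 0 ≤ f p.1 := Measure.quasiMeasurePreserving_fst.ae h0
  have h2 : ∀ᵐ p : X × X ∂(μ.prod μ), 0 ≤ f p.2 := Measure.quasiMeasurePreserving_snd.ae h0
  filter_upwards [h1, h2] with p h1 h2 using mul_nonneg h1 h2

end MeasureTheory

/-! ### The equilibrium density as a time average of arcsine laws, and its potential. -/

namespace Meixner

open Real Set Filter Topology LogKernel

variable {c β : ℝ}

/-- The density at `x` of the arcsine law at time `t`. -/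
noncomputable def kern (c β t x : ℝ) : ℝ := ArcsineLaw.density (lower c β t) (upper c β t) x

/-- The equilibrium density: the average of the arcsine laws over the times in `(0, 1)`. -/
noncomputable def eqDensity (c β x : ℝ) : ℝ := ∫ t in Ioo (0 : ℝ) 1, kern c β t x

theorem kern_nonneg (t x : ℝ) : 0 ≤ kern c β t x := ArcsineLaw.density_nonneg _ _ _

@[fun_prop]
theorem measurable_kern : Measurable fun p : ℝ × ℝ => kern c β p.1 p.2 := by
  have h : Measurable fun p : ℝ × ℝ => (lower c β p.1, upper c β p.1, p.2) := by fun_prop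
  simpa only [Function.comp_def, kern] using ArcsineLaw.measurable_density.comp h

theorem mem_of_kern_ne_zero (hc1 : c < 1) {t x : ℝ} (h : kern c β t x ≠ 0) :
    x ∈ Ioo (lower c β t) (upper c β t) := by
  by_contra H
  exact h (ArcsineLaw.density_eq_zero (lower_le_upper hc1 t) H)

theorem upper_mono (hc0 : 0 < c) (hc1 : c < 1) {t t' : ℝ} (h : t ≤ t') :
    upper c β t ≤ upper c β t' := by
  unfold upper
  have : 0 < 1 - c := by linarith
  gcongr

theorem eqDensity_nonneg (x : ℝ) : 0 ≤ eqDensity c β x :=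
  integral_nonneg fun t => kern_nonneg t x

theorem eqDensity_eq_zero_of_notMem (hc0 : 0 < c) (hc1 : c < 1) {x : ℝ}
    (hx : x ∉ Ioo 0 (upper c β 1)) : eqDensity c β x = 0 := by
  refine setIntegral_eq_zero_of_forall_eq_zero fun t ht => ?_
  by_contra H
  have := mem_of_kern_ne_zero hc1 H
  exact hx ⟨(lower_nonneg hc1 t).trans_lt this.1, this.2.trans_le (upper_mono hc0 hc1 ht.2.le)⟩

theorem lintegral_kern_space (hc0 : 0 < c) (hc1 : c < 1) (hβ : 0 ≤ β) {t : ℝ} (ht : 0 < t) :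
    ∫⁻ x, ENNReal.ofReal (kern c β t x) = 1 :=
  ArcsineLaw.lintegral_density (lower_lt_upper hc0 hc1 hβ ht)

/-- By duality the kernel at fixed `x` is itself an arcsine density in time. This is the source of
the bound `eqDensity ≤ 1`. -/
theorem lintegral_kern_time (hc0 : 0 < c) (hc1 : c < 1) (hβ : 0 ≤ β) {x : ℝ} (hx : 0 < x) :
    ∫⁻ t in Ioi 0, ENNReal.ofReal (kern c β t x) = 1 := by
  rw [← ArcsineLaw.lintegral_density (lower_lt_upper hc0 hc1 hβ hx),
    ← setLIntegral_eq_of_support_subset (s := Ioi 0) (μ := volume)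
      (f := fun t => ENNReal.ofReal (ArcsineLaw.density (lower c β x) (upper c β x) t))]
  · refine setLIntegral_congr_fun measurableSet_Ioi fun t ht => ?_
    rw [kern, density_symm hc0 hc1 hβ hx.le (le_of_lt ht)]
  · intro t ht
    by_contra H
    have : t ∉ Ioo (lower c β x) (upper c β x) :=
      fun h => H ((lower_nonneg hc1 x).trans_lt h.1)
    simp [ArcsineLaw.density_eq_zero (lower_le_upper hc1 x) this] at ht

theorem integrableOn_kern_time (hc0 : 0 < c) (hc1 : c < 1) (hβ : 0 ≤ β) (x : ℝ) :
    IntegrableOn (fun t => kern c β t x) (Ioo 0 1) := by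
  rcases le_or_gt x 0 with hx | hx
  · refine (integrable_zero _ _ _).congr (Eventually.of_forall fun t => ?_)
    by_contra H
    have := mem_of_kern_ne_zero hc1 (Ne.symm H)
    linarith [this.1, lower_nonneg (β := β) hc1 t]
  · have hm : Measurable fun t => kern c β t x := by
      simpa only [Function.comp_def] using
        (measurable_kern (c := c) (β := β)).comp (measurable_prodMk_right (y := x))
    refine IntegrableOn.mono_set (t := Ioi 0) ⟨hm.aestronglyMeasurable, ?_⟩ Ioo_subset_Ioi_self
    rw [hasFiniteIntegral_iff_ofReal (Eventually.of_forall fun t => kern_nonneg t x),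
      lintegral_kern_time hc0 hc1 hβ hx]
    exact ENNReal.one_lt_top

theorem ofReal_eqDensity (hc0 : 0 < c) (hc1 : c < 1) (hβ : 0 ≤ β) (x : ℝ) :
    ENNReal.ofReal (eqDensity c β x) = ∫⁻ t in Ioo 0 1, ENNReal.ofReal (kern c β t x) :=
  ofReal_integral_eq_lintegral_ofReal (integrableOn_kern_time hc0 hc1 hβ x)
    (Eventually.of_forall fun t => kern_nonneg t x)

theorem eqDensity_le_one (hc0 : 0 < c) (hc1 : c < 1) (hβ : 0 ≤ β) (x : ℝ) :
    eqDensity c β x ≤ 1 := by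
  rcases le_or_gt x 0 with hx | hx
  · rw [eqDensity_eq_zero_of_notMem hc0 hc1 fun h => absurd h.1 (not_lt.2 hx)]
    exact zero_le_one
  · rw [← ENNReal.ofReal_le_one, ofReal_eqDensity hc0 hc1 hβ, ← lintegral_kern_time hc0 hc1 hβ hx]
    exact lintegral_mono_set Ioo_subset_Ioi_self

theorem eqDensity_eq_zero_of_one_le_lower (hc0 : 0 < c) (hc1 : c < 1) (hβ : 0 ≤ β) {x : ℝ}
    (hx : 0 < x) (h : 1 ≤ lower c β x) : eqDensity c β x = 0 := by
  refine setIntegral_eq_zero_of_forall_eq_zero fun t ht => ?_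
  rw [kern, density_symm hc0 hc1 hβ hx.le ht.1.le]
  exact ArcsineLaw.density_eq_zero (lower_le_upper hc1 x) fun H => by linarith [H.1, ht.2]

/-- Saturation: the times in `(0, 1)` already exhaust the arcsine law on `[lower x, upper x]`. -/
theorem eqDensity_eq_one_of_upper_le_one (hc0 : 0 < c) (hc1 : c < 1) (hβ : 0 ≤ β) {x : ℝ}
    (hx : 0 < x) (h : upper c β x ≤ 1) : eqDensity c β x = 1 := by
  rw [← ENNReal.ofReal_eq_one, ofReal_eqDensity hc0 hc1 hβ,
    ← ArcsineLaw.lintegral_density (lower_lt_upper hc0 hc1 hβ hx),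
    ← setLIntegral_eq_of_support_subset (s := Ioo 0 1) (μ := volume)
      (f := fun t => ENNReal.ofReal (ArcsineLaw.density (lower c β x) (upper c β x) t))]
  · refine setLIntegral_congr_fun measurableSet_Ioo fun t ht => ?_
    rw [kern, density_symm hc0 hc1 hβ hx.le ht.1.le]
  · intro t ht
    by_contra H
    have : t ∉ Ioo (lower c β x) (upper c β x) :=
      fun h' => H ⟨(lower_nonneg hc1 x).trans_lt h'.1, h'.2.trans_le h⟩
    simp [ArcsineLaw.density_eq_zero (lower_le_upper hc1 x) this] at ht

/-- The law of a position together with its time. -/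
noncomputable def joint (c β : ℝ) : Measure (ℝ × ℝ) :=
  (volume.prod (volume.restrict (Ioo 0 1))).withDensity
    fun p => ENNReal.ofReal (kern c β p.2 p.1)

theorem measurable_kern_swap : Measurable fun p : ℝ × ℝ => kern c β p.2 p.1 := by
  simpa only [Function.comp_def, Prod.fst_swap, Prod.snd_swap] using
    (measurable_kern (c := c) (β := β)).comp measurable_swap

theorem joint_apply {s : Set (ℝ × ℝ)} (hs : MeasurableSet s) :
    joint c β s = ∫⁻ p, s.indicator (fun p => ENNReal.ofReal (kern c β p.2 p.1)) p
      ∂(volume.prod (volume.restrict (Ioo 0 1))) := by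
  rw [joint, withDensity_apply _ hs, lintegral_indicator hs]

theorem map_fst_joint (hc0 : 0 < c) (hc1 : c < 1) (hβ : 0 ≤ β) :
    (joint c β).map Prod.fst = volume.withDensity fun x => ENNReal.ofReal (eqDensity c β x) := by
  ext s hs
  rw [Measure.map_apply measurable_fst hs, joint_apply (measurable_fst hs),
    withDensity_apply _ hs, ← lintegral_indicator hs, lintegral_prod]
  · refine lintegral_congr fun x => ?_
    by_cases hx : x ∈ s
    · simp [indicator, hx, ofReal_eqDensity hc0 hc1 hβ]
    · simp [indicator, hx]
  · exact (measurable_kern_swap.ennreal_ofReal.indicator (measurable_fst hs)).aemeasurable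

theorem map_snd_joint (hc0 : 0 < c) (hc1 : c < 1) (hβ : 0 ≤ β) :
    (joint c β).map Prod.snd = volume.restrict (Ioo 0 1) := by
  ext s hs
  rw [Measure.map_apply measurable_snd hs, joint_apply (measurable_snd hs), lintegral_prod_symm']
  · rw [← setLIntegral_one, ← lintegral_indicator hs]
    refine setLIntegral_congr_fun measurableSet_Ioo fun t ht => ?_
    by_cases hx : t ∈ s
    · simp [indicator, hx, lintegral_kern_space hc0 hc1 hβ ht.1]
    · simp [indicator, hx]
  · exact measurable_kern_swap.ennreal_ofReal.indicator (measurable_snd hs)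

theorem isProbabilityMeasure_joint (hc0 : 0 < c) (hc1 : c < 1) (hβ : 0 ≤ β) :
    IsProbabilityMeasure (joint c β) := by
  constructor
  rw [← preimage_univ (f := Prod.snd), ← Measure.map_apply measurable_snd MeasurableSet.univ,
    map_snd_joint hc0 hc1 hβ]
  simp

theorem ae_joint_mem (hc1 : c < 1) : ∀ᵐ p ∂(joint c β),
    p.2 ∈ Ioo (0 : ℝ) 1 ∧ p.1 ∈ Ioo (lower c β p.2) (upper c β p.2) := by
  rw [joint, ae_withDensity_iff measurable_kern_swap.ennreal_ofReal]
  have : ∀ᵐ p : ℝ × ℝ ∂(volume.prod (volume.restrict (Ioo (0 : ℝ) 1))), p.2 ∈ Ioo (0 : ℝ) 1 :=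
    Measure.quasiMeasurePreserving_snd.ae (ae_restrict_mem measurableSet_Ioo)
  filter_upwards [this] with p hp h
  exact ⟨hp, mem_of_kern_ne_zero hc1 fun H => h (by simp [H])⟩

theorem measurable_eqDensity : Measurable (eqDensity c β) :=
  (measurable_kern_swap.stronglyMeasurable.integral_prod_right'
    (ν := volume.restrict (Ioo 0 1))).measurable

theorem lintegral_eqDensity (hc0 : 0 < c) (hc1 : c < 1) (hβ : 0 ≤ β) :
    ∫⁻ x, ENNReal.ofReal (eqDensity c β x) = 1 := by
  have := isProbabilityMeasure_joint hc0 hc1 hβ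
  have h := congrArg (fun m => m univ) (map_fst_joint hc0 hc1 hβ)
  simp only [Measure.map_apply measurable_fst MeasurableSet.univ, preimage_univ, measure_univ,
    withDensity_apply _ MeasurableSet.univ, Measure.restrict_univ] at h
  exact h.symm

theorem integrable_eqDensity (hc0 : 0 < c) (hc1 : c < 1) (hβ : 0 ≤ β) :
    Integrable (eqDensity c β) := by
  refine ⟨measurable_eqDensity.aestronglyMeasurable, ?_⟩
  rw [hasFiniteIntegral_iff_ofReal (Eventually.of_forall eqDensity_nonneg),
    lintegral_eqDensity hc0 hc1 hβ]
  exact ENNReal.one_lt_top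

theorem integral_eqDensity (hc0 : 0 < c) (hc1 : c < 1) (hβ : 0 ≤ β) :
    ∫ x, eqDensity c β x = 1 := by
  rw [integral_eq_lintegral_of_nonneg_ae (Eventually.of_forall eqDensity_nonneg)
    measurable_eqDensity.aestronglyMeasurable, lintegral_eqDensity hc0 hc1 hβ, ENNReal.toReal_one]

theorem abs_eqDensity_le (hc0 : 0 < c) (hc1 : c < 1) (hβ : 0 ≤ β) (x : ℝ) :
    |eqDensity c β x| ≤ 1 := by
  rw [abs_of_nonneg (eqDensity_nonneg x)]
  exact eqDensity_le_one hc0 hc1 hβ x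

theorem integrable_continuous_mul_eqDensity (hc0 : 0 < c) (hc1 : c < 1) (hβ : 0 ≤ β)
    {g : ℝ → ℝ} (hg : Continuous g) : Integrable fun x => g x * eqDensity c β x := by
  obtain ⟨C, hC⟩ := (isCompact_Icc (a := 0) (b := upper c β 1)).exists_bound_of_continuousOn
    hg.continuousOn
  refine Integrable.mono' ((integrable_eqDensity hc0 hc1 hβ).const_mul C)
    (hg.measurable.mul measurable_eqDensity).aestronglyMeasurable (Eventually.of_forall fun x => ?_)
  by_cases hx : x ∈ Ioo 0 (upper c β 1)
  · rw [norm_mul, norm_of_nonneg (eqDensity_nonneg x)]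
    exact mul_le_mul_of_nonneg_right (hC x (Ioo_subset_Icc_self hx)) (eqDensity_nonneg x)
  · simp [eqDensity_eq_zero_of_notMem hc0 hc1 hx]

/-- The logarithmic potential of the arcsine law at time `t`. -/
noncomputable def arcPot (c β t x : ℝ) : ℝ :=
  log ((upper c β t - lower c β t) / 4) + green c β t x

theorem integral_kern_mul_log (hc0 : 0 < c) (hc1 : c < 1) (hβ : 0 ≤ β) {t : ℝ} (ht : 0 < t)
    (x : ℝ) : ∫ y, kern c β t y * log (x - y) = arcPot c β t x := by
  rw [arcPot, green, ← ArcsineLaw.integral_log_mul_density (lower_lt_upper hc0 hc1 hβ ht)]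
  simp_rw [log_abs, kern, mul_comm]

/-- Integrating over time first turns the kernel into the bounded function `eqDensity`, against
which the logarithmic singularity is integrable. -/
theorem integrable_kern_mul_log (hc0 : 0 < c) (hc1 : c < 1) (hβ : 0 ≤ β) (x : ℝ) :
    Integrable (fun p : ℝ × ℝ => kern c β p.2 p.1 * log (x - p.1))
      (volume.prod (volume.restrict (Ioo 0 1))) := by
  rw [integrable_prod_iff]
  · refine ⟨Eventually.of_forall fun y => (integrableOn_kern_time hc0 hc1 hβ y).mul_const (log (x - y)), ?_⟩
    have h := (integrable_mul_log_sub (integrable_eqDensity hc0 hc1 hβ)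
      (Eventually.of_forall (abs_eqDensity_le hc0 hc1 hβ))
      (integrable_continuous_mul_eqDensity hc0 hc1 hβ continuous_id) x).abs
    refine h.congr (Eventually.of_forall fun y => ?_)
    simp only [norm_mul, norm_eq_abs, abs_mul, abs_of_nonneg (eqDensity_nonneg _),
      abs_of_nonneg (kern_nonneg _ _)]
    rw [integral_mul_const, eqDensity]
  · exact (measurable_kern_swap.mul (measurable_log.comp (by fun_prop))).aestronglyMeasurable

theorem integrableOn_arcPot (hc0 : 0 < c) (hc1 : c < 1) (hβ : 0 ≤ β) (x : ℝ) :
    IntegrableOn (fun t => arcPot c β t x) (Ioo 0 1) := by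
  refine (integrable_kern_mul_log hc0 hc1 hβ x).integral_prod_right.congr ?_
  exact (ae_restrict_mem measurableSet_Ioo).mono
    fun t ht => integral_kern_mul_log hc0 hc1 hβ ht.1 x

/-- The logarithmic potential of the equilibrium density. -/
noncomputable def eqPot (c β x : ℝ) : ℝ := ∫ y, eqDensity c β y * log (x - y)

theorem eqPot_eq (hc0 : 0 < c) (hc1 : c < 1) (hβ : 0 ≤ β) (x : ℝ) :
    eqPot c β x = ∫ t in Ioo 0 1, arcPot c β t x := by
  have h1 := integral_integral_swap (f := fun y t => kern c β t y * log (x - y))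
    (integrable_kern_mul_log hc0 hc1 hβ x)
  rw [eqPot]
  simp_rw [integral_mul_const] at h1
  rw [show (fun y => eqDensity c β y * log (x - y))
    = fun y => (∫ t in Ioo 0 1, kern c β t y) * log (x - y) from rfl, h1]
  exact setIntegral_congr_fun measurableSet_Ioo
    fun t ht => integral_kern_mul_log hc0 hc1 hβ ht.1 x

end Meixner

/-! ### Euler–Lagrange conditions and the value of the equilibrium energy. -/

namespace Meixner

open Real Set Filter Topology LogKernel

variable {c β : ℝ}

/-- The integral over the times in `(0, T)` of the logarithmic capacities of the supports. -/
noncomputable def logCap (c β T : ℝ) : ℝ :=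
  (T * log c + T * log T + (T + β) * log (T + β) - β * log β) / 2 - T - T * log (1 - c)

@[fun_prop]
theorem continuous_logCap : Continuous (logCap c β) := by
  unfold logCap
  have h1 : Continuous fun x : ℝ => x * log x := continuous_mul_log
  have h2 : Continuous fun x : ℝ => (x + β) * log (x + β) :=
    continuous_mul_log.comp (continuous_id.add continuous_const)
  fun_prop

theorem log_capacity (hc0 : 0 < c) (hc1 : c < 1) (hβ : 0 ≤ β) {t : ℝ} (ht : 0 < t) :
    log ((upper c β t - lower c β t) / 4)
      = (log c / 2 - log (1 - c)) + (log (t + β) / 2 + log t / 2) := by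
  have hd : 0 < 1 - c := by linarith
  rw [upper_sub_lower hc1, show 4 * (√(c * (t + β)) * √t) / (1 - c) / 4
    = √(c * (t + β)) * √t / (1 - c) by ring, log_div (by positivity) hd.ne',
    log_mul (by positivity) (by positivity), log_sqrt (by positivity), log_sqrt ht.le,
    log_mul hc0.ne' (by positivity)]
  ring

theorem intervalIntegrable_log_add_const (β a b : ℝ) :
    IntervalIntegrable (fun t => log (t + β)) volume a b := by
  have := (intervalIntegral.intervalIntegrable_log' (a := a + β) (b := b + β)).comp_add_right β
  simpa using this

theorem integrableOn_log_capacity (hc0 : 0 < c) (hc1 : c < 1) (hβ : 0 ≤ β) {T : ℝ}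
    (hT : 0 ≤ T) : IntegrableOn (fun t => log ((upper c β t - lower c β t) / 4)) (Ioo 0 T) ∧
      ∫ t in Ioo 0 T, log ((upper c β t - lower c β t) / 4) = logCap c β T := by
  have i1 : IntervalIntegrable (fun t => log (t + β) / 2) volume 0 T :=
    (intervalIntegrable_log_add_const β 0 T).div_const 2
  have i2 : IntervalIntegrable (fun t => log t / 2) volume 0 T :=
    intervalIntegral.intervalIntegrable_log'.div_const 2
  have i3 : IntervalIntegrable (fun _ => log c / 2 - log (1 - c)) volume 0 T :=
    intervalIntegrable_const
  have hI := i3.add (i1.add i2)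
  constructor
  · rw [intervalIntegrable_iff_integrableOn_Ioo_of_le hT] at hI
    exact hI.congr_fun (fun t ht => (log_capacity hc0 hc1 hβ ht.1).symm) measurableSet_Ioo
  · rw [setIntegral_congr_fun measurableSet_Ioo fun _ ht => log_capacity hc0 hc1 hβ ht.1,
      ← integral_Ioc_eq_integral_Ioo, ← intervalIntegral.integral_of_le hT,
      intervalIntegral.integral_add i3 (i1.add i2), intervalIntegral.integral_add i1 i2,
      intervalIntegral.integral_const, intervalIntegral.integral_div,
      intervalIntegral.integral_div, intervalIntegral.integral_comp_add_right (fun t => log t),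
      integral_log, integral_log, logCap, smul_eq_mul]
    simp only [zero_add, log_zero, mul_zero]
    ring

theorem green_nonneg (hc0 : 0 < c) (hc1 : c < 1) (hβ : 0 ≤ β) {t : ℝ} (ht : 0 < t) (x : ℝ) :
    0 ≤ green c β t x := ArcsineLaw.green_nonneg (lower_lt_upper hc0 hc1 hβ ht) x

theorem green_eq_zero (hc0 : 0 < c) (hc1 : c < 1) (hβ : 0 ≤ β) {x t : ℝ} (hx : 0 < x)
    (ht : 0 < t) (h1 : lower c β x ≤ t) (h2 : t ≤ upper c β x) : green c β t x = 0 := by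
  have hd := duality hc0 hc1 hβ hx.le ht.le
  have hl := lower_lt_upper hc0 hc1 hβ ht
  have hp : 0 ≤ (x - lower c β t) * (upper c β t - x) := by
    rw [hd]; exact mul_nonneg (by linarith) (by linarith)
  refine ArcsineLaw.green_of_mem ⟨?_, ?_⟩
  · by_contra! H
    nlinarith [mul_pos (sub_pos.2 H) (show 0 < upper c β t - x by linarith)]
  · by_contra! H
    nlinarith [mul_pos (sub_pos.2 H) (show 0 < x - lower c β t by linarith)]

theorem measurable_green_time (x : ℝ) : Measurable fun t => green c β t x := by
  simpa only [Function.comp_def] using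
    (measurable_green (c := c) (β := β)).comp (measurable_prodMk_right (y := x))

theorem green_nonneg_ae (hc0 : 0 < c) (hc1 : c < 1) (hβ : 0 ≤ β) (x T : ℝ) :
    ∀ᵐ t ∂(volume.restrict (Ioo 0 T)), 0 ≤ green c β t x :=
  (ae_restrict_mem measurableSet_Ioo).mono fun _ ht => green_nonneg hc0 hc1 hβ ht.1 x

theorem integrableOn_green_lower (hc0 : 0 < c) (hc1 : c < 1) (hβ : 0 ≤ β) {x : ℝ} (hx : 0 < x) :
    IntegrableOn (fun t => green c β t x) (Ioo 0 (lower c β x)) := by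
  refine ⟨(measurable_green_time x).aestronglyMeasurable, ?_⟩
  rw [hasFiniteIntegral_iff_ofReal (green_nonneg_ae hc0 hc1 hβ x _),
    (pot_base_le_and_lintegral_green hc0 hc1 hβ hx).2]
  exact ENNReal.ofReal_lt_top

theorem integral_green_lower (hc0 : 0 < c) (hc1 : c < 1) (hβ : 0 ≤ β) {x : ℝ} (hx : 0 < x) :
    ∫ t in Ioo 0 (lower c β x), green c β t x = (pot c β x - pot c β (base c β)) / 2 := by
  have h := pot_base_le_and_lintegral_green hc0 hc1 hβ hx
  rw [integral_eq_lintegral_of_nonneg_ae (green_nonneg_ae hc0 hc1 hβ x _)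
    (measurable_green_time x).aestronglyMeasurable, h.2, ENNReal.toReal_ofReal]
  linarith [h.1]

/-- Between the times `lower x` and `upper x` the point `x` is in the support and the Green function
vanishes, so nothing is added after `lower x`. -/
theorem integral_green_of_mem (hc0 : 0 < c) (hc1 : c < 1) (hβ : 0 ≤ β) {x T : ℝ} (hx : 0 < x)
    (h1 : lower c β x ≤ T) (h2 : T ≤ upper c β x) :
    ∫ t in Ioo 0 T, green c β t x = (pot c β x - pot c β (base c β)) / 2 := by
  rw [← integral_green_lower hc0 hc1 hβ hx]
  refine setIntegral_eq_of_subset_of_forall_sdiff_eq_zero measurableSet_Ioo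
    (Ioo_subset_Ioo_right h1) fun t ht => ?_
  have : lower c β x ≤ t := by
    by_contra! H
    exact ht.2 ⟨ht.1.1, H⟩
  exact green_eq_zero hc0 hc1 hβ hx ht.1.1 this (ht.1.2.le.trans h2)

theorem integrableOn_green (hc0 : 0 < c) (hc1 : c < 1) (hβ : 0 ≤ β) (x : ℝ) :
    IntegrableOn (fun t => green c β t x) (Ioo 0 1) := by
  refine ((integrableOn_arcPot hc0 hc1 hβ x).sub
    (integrableOn_log_capacity hc0 hc1 hβ zero_le_one).1).congr
    (Eventually.of_forall fun t => ?_)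
  simp [arcPot]

theorem integral_arcPot (hc0 : 0 < c) (hc1 : c < 1) (hβ : 0 ≤ β) (x : ℝ) {T : ℝ} (h0 : 0 ≤ T)
    (h1 : T ≤ 1) : ∫ t in Ioo 0 T, arcPot c β t x
      = logCap c β T + ∫ t in Ioo 0 T, green c β t x := by
  rw [← (integrableOn_log_capacity hc0 hc1 hβ h0).2]
  exact integral_add (integrableOn_log_capacity hc0 hc1 hβ h0).1
    ((integrableOn_green hc0 hc1 hβ x).mono_set (Ioo_subset_Ioo_right h1))

/-- The effective potential, normalised to vanish on the band. -/
noncomputable def excess (c β x : ℝ) : ℝ :=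
  pot c β x - pot c β (base c β) - 2 * eqPot c β x + 2 * logCap c β 1

/-- The Euler–Lagrange conditions of the constrained equilibrium problem. -/
theorem excess_trichotomy (hc0 : 0 < c) (hc1 : c < 1) (hβ : 0 ≤ β) {x : ℝ} (hx : 0 < x) :
    (0 ≤ excess c β x ∧ eqDensity c β x = 0) ∨ excess c β x = 0 ∨
      (excess c β x ≤ 0 ∧ eqDensity c β x = 1) := by
  have he : excess c β x = 2 * ((pot c β x - pot c β (base c β)) / 2)
      - 2 * ∫ t in Ioo 0 1, green c β t x := by
    rw [excess, eqPot_eq hc0 hc1 hβ, integral_arcPot hc0 hc1 hβ x zero_le_one le_rfl]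
    ring
  -- `excess` is twice the Green integral over times below `lower x` minus twice the one over times
  -- below `1`. Stopping before `lower x` leaves it nonnegative, stopping inside `[lower x, upper
  -- x]` makes it zero, and stopping later makes it nonpositive.
  rcases le_or_gt 1 (lower c β x) with h1 | h1
  · left
    refine ⟨?_, eqDensity_eq_zero_of_one_le_lower hc0 hc1 hβ hx h1⟩
    rw [he, ← integral_green_lower hc0 hc1 hβ hx]
    have := setIntegral_mono_set (integrableOn_green_lower hc0 hc1 hβ hx)
      (green_nonneg_ae hc0 hc1 hβ x _) (Ioo_subset_Ioo_right h1).eventuallyLE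
    linarith
  rcases le_or_gt 1 (upper c β x) with h2 | h2
  · right; left
    rw [he, integral_green_of_mem hc0 hc1 hβ hx h1.le h2]
    ring
  · right; right
    refine ⟨?_, eqDensity_eq_one_of_upper_le_one hc0 hc1 hβ hx h2.le⟩
    rw [he, ← integral_green_lower hc0 hc1 hβ hx]
    have := setIntegral_mono_set (integrableOn_green hc0 hc1 hβ x)
      (green_nonneg_ae hc0 hc1 hβ x _) (Ioo_subset_Ioo_right h1.le).eventuallyLE
    linarith

theorem stronglyMeasurable_eqPot : StronglyMeasurable (eqPot c β) := by
  refine StronglyMeasurable.integral_prod_right'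
    (f := fun p : ℝ × ℝ => eqDensity c β p.2 * log (p.1 - p.2)) ?_
  exact ((measurable_eqDensity.comp measurable_snd).mul
    (measurable_log.comp (by fun_prop))).stronglyMeasurable

theorem integrable_log_sub_eqDensity (hc0 : 0 < c) (hc1 : c < 1) (hβ : 0 ≤ β) :
    Integrable (fun p : ℝ × ℝ => eqDensity c β p.1 * eqDensity c β p.2 * log (p.1 - p.2))
      (volume.prod volume) :=
  integrable_mul_mul_log_sub (integrable_eqDensity hc0 hc1 hβ) (integrable_eqDensity hc0 hc1 hβ)
    (Eventually.of_forall (abs_eqDensity_le hc0 hc1 hβ))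
    (integrable_continuous_mul_eqDensity hc0 hc1 hβ continuous_id)
    (integrable_continuous_mul_eqDensity hc0 hc1 hβ continuous_id)

theorem integrable_log_sub_joint (hc0 : 0 < c) (hc1 : c < 1) (hβ : 0 ≤ β) :
    Integrable (fun r : (ℝ × ℝ) × (ℝ × ℝ) => log (r.1.1 - r.2.1))
      ((joint c β).prod (joint c β)) := by
  have := isProbabilityMeasure_joint hc0 hc1 hβ
  have hm : Measurable fun p : ℝ × ℝ => log (p.1 - p.2) := measurable_log.comp (by fun_prop)
  have hψ : Measurable fun p : ℝ × ℝ => eqDensity c β p.1 * eqDensity c β p.2 :=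
    (measurable_eqDensity.comp measurable_fst).mul (measurable_eqDensity.comp measurable_snd)
  have h1 : Integrable (fun p : ℝ × ℝ => log (p.1 - p.2))
      (((joint c β).map Prod.fst).prod ((joint c β).map Prod.fst)) := by
    rw [map_fst_joint hc0 hc1 hβ, withDensity_ofReal_prod measurable_eqDensity.aemeasurable
      (Eventually.of_forall eqDensity_nonneg), integrable_withDensity_ofReal_iff
      hψ.aemeasurable
      (ae_nonneg_mul_prod (Eventually.of_forall eqDensity_nonneg))]
    exact integrable_log_sub_eqDensity hc0 hc1 hβ
  rw [Measure.map_prod_map _ _ measurable_fst measurable_fst,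
    integrable_map_measure hm.aestronglyMeasurable (by fun_prop)] at h1
  exact h1

theorem integral_comp_fst_joint (hc0 : 0 < c) (hc1 : c < 1) (hβ : 0 ≤ β) {g : ℝ → ℝ}
    (hg : StronglyMeasurable g) :
    ∫ p, g p.1 ∂(joint c β) = ∫ x, eqDensity c β x * g x := by
  rw [← integral_withDensity_ofReal measurable_eqDensity.aemeasurable
    (Eventually.of_forall eqDensity_nonneg), ← map_fst_joint hc0 hc1 hβ,
    integral_map measurable_fst.aemeasurable hg.aestronglyMeasurable]

theorem integral_log_sub_joint (hc0 : 0 < c) (hc1 : c < 1) (hβ : 0 ≤ β) :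
    ∫ r, log (r.1.1 - r.2.1) ∂((joint c β).prod (joint c β))
      = ∫ x, eqDensity c β x * eqPot c β x := by
  have := isProbabilityMeasure_joint hc0 hc1 hβ
  rw [integral_prod _ (integrable_log_sub_joint hc0 hc1 hβ),
    ← integral_comp_fst_joint hc0 hc1 hβ stronglyMeasurable_eqPot]
  refine integral_congr_ae (Eventually.of_forall fun p => ?_)
  exact integral_comp_fst_joint hc0 hc1 hβ
    (measurable_log.comp (by fun_prop : Measurable fun y : ℝ => p.1 - y)).stronglyMeasurable

theorem ae_snd_ne (hc0 : 0 < c) (hc1 : c < 1) (hβ : 0 ≤ β) :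
    ∀ᵐ r ∂((joint c β).prod (joint c β)), r.2.2 ≠ r.1.2 := by
  have := isProbabilityMeasure_joint hc0 hc1 hβ
  rw [Measure.ae_prod_iff_ae_ae]
  · refine Eventually.of_forall fun p => ?_
    have : ∀ᵐ t ∂((joint c β).map Prod.snd), t ≠ p.2 := by
      rw [map_snd_joint hc0 hc1 hβ]
      exact ae_restrict_of_ae (by simp [ae_iff])
    exact ae_of_ae_map measurable_snd.aemeasurable this
  · exact (measurableSet_eq_fun (by fun_prop) (by fun_prop)).compl

/-- The integrand is symmetric and the two times almost surely differ, so both orderings contribute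
equally. -/
theorem integral_log_sub_joint_eq_two_mul (hc0 : 0 < c) (hc1 : c < 1) (hβ : 0 ≤ β) :
    ∫ r, log (r.1.1 - r.2.1) ∂((joint c β).prod (joint c β))
      = 2 * ∫ r, {r : (ℝ × ℝ) × (ℝ × ℝ) | r.2.2 < r.1.2}.indicator
        (fun r => log (r.1.1 - r.2.1)) r ∂((joint c β).prod (joint c β)) := by
  have := isProbabilityMeasure_joint hc0 hc1 hβ
  have hI := integrable_log_sub_joint hc0 hc1 hβ
  have hA : MeasurableSet {r : (ℝ × ℝ) × (ℝ × ℝ) | r.2.2 < r.1.2} :=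
    measurableSet_lt (by fun_prop) (by fun_prop)
  have hs := integral_prod_swap (μ := joint c β) (ν := joint c β)
    ({r : (ℝ × ℝ) × (ℝ × ℝ) | r.2.2 < r.1.2}.indicator (fun r => log (r.1.1 - r.2.1)))
  have hsi := (hI.indicator hA).swap
  refine Eq.trans ?_ ((congrArg₂ (· + ·) rfl hs).trans (two_mul _).symm)
  refine Eq.trans ?_ (integral_add (hI.indicator hA) hsi)
  refine integral_congr_ae ((ae_snd_ne hc0 hc1 hβ).mono fun r hr => ?_)
  rcases lt_or_gt_of_ne hr with h | h
  · simp [indicator, h, h.not_gt]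
  · simp [indicator, h, h.not_gt]
    rw [← log_abs, abs_sub_comm, log_abs]

theorem integral_indicator_log_sub_joint (hc0 : 0 < c) (hc1 : c < 1) (hβ : 0 ≤ β) (x : ℝ) {T : ℝ}
    (hT : T ≤ 1) :
    ∫ q, {q : ℝ × ℝ | q.2 < T}.indicator (fun q => log (x - q.1)) q ∂(joint c β)
      = ∫ t in Ioo 0 T, arcPot c β t x := by
  have hA : MeasurableSet {q : ℝ × ℝ | q.2 < T} := measurableSet_lt (by fun_prop) (by fun_prop)
  have hI := (integrable_kern_mul_log hc0 hc1 hβ x).indicator hA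
  rw [joint, integral_withDensity_ofReal measurable_kern_swap.aemeasurable
    (Eventually.of_forall fun p => kern_nonneg _ _)]
  have e1 : (fun q : ℝ × ℝ => kern c β q.2 q.1 *
      {q : ℝ × ℝ | q.2 < T}.indicator (fun q => log (x - q.1)) q)
      = {q : ℝ × ℝ | q.2 < T}.indicator fun q => kern c β q.2 q.1 * log (x - q.1) := by
    ext q
    by_cases h : q.2 < T <;> simp [indicator, h]
  rw [e1, integral_prod_symm _ hI]
  have e2 : ∀ t ∈ Ioo (0 : ℝ) 1, ∫ y, {q : ℝ × ℝ | q.2 < T}.indicator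
      (fun q => kern c β q.2 q.1 * log (x - q.1)) (y, t)
      = (Iio T).indicator (fun t => arcPot c β t x) t := by
    intro t ht
    by_cases h : t < T
    · simp [indicator, h, integral_kern_mul_log hc0 hc1 hβ ht.1]
    · simp [indicator, h]
  rw [setIntegral_congr_fun measurableSet_Ioo e2, setIntegral_indicator measurableSet_Iio]
  congr 2
  ext t
  simp only [mem_inter_iff, mem_Ioo, mem_Iio]
  constructor
  · exact fun h => ⟨h.1.1, h.2⟩
  · exact fun h => ⟨⟨h.1, h.2.trans_le hT⟩, h.2⟩

/-- For a first point `(x, T)`, the second point with time below `T` contributes the potential at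
`x` of the laws before `T`, which is `(pot x - pot base) / 2 + logCap T`. Averaging uses that
positions have density `eqDensity` and times are uniform on `(0, 1)`. -/
theorem integral_eqDensity_mul_eqPot (hc0 : 0 < c) (hc1 : c < 1) (hβ : 0 ≤ β) :
    ∫ x, eqDensity c β x * eqPot c β x = (∫ x, eqDensity c β x * pot c β x)
      - pot c β (base c β) + 2 * ∫ T in Ioo 0 1, logCap c β T := by
  have := isProbabilityMeasure_joint hc0 hc1 hβ
  have hI := (integrable_log_sub_joint hc0 hc1 hβ).indicator
    (show MeasurableSet {r : (ℝ × ℝ) × (ℝ × ℝ) | r.2.2 < r.1.2} from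
      measurableSet_lt (by fun_prop) (by fun_prop))
  rw [← integral_log_sub_joint hc0 hc1 hβ, integral_log_sub_joint_eq_two_mul hc0 hc1 hβ,
    integral_prod _ hI]
  have i1 : Integrable (fun p : ℝ × ℝ => pot c β p.1) (joint c β) := by
    have : Integrable (pot c β) ((joint c β).map Prod.fst) := by
      rw [map_fst_joint hc0 hc1 hβ, integrable_withDensity_ofReal_iff
        measurable_eqDensity.aemeasurable (Eventually.of_forall eqDensity_nonneg)]
      simpa only [mul_comm] using
        integrable_continuous_mul_eqDensity hc0 hc1 hβ (continuous_pot c β)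
    exact (integrable_map_measure (continuous_pot c β).aestronglyMeasurable
      measurable_fst.aemeasurable).1 this
  have i2 : Integrable (fun p : ℝ × ℝ => logCap c β p.2) (joint c β) := by
    have : Integrable (logCap c β) ((joint c β).map Prod.snd) := by
      rw [map_snd_joint hc0 hc1 hβ]
      exact (continuous_logCap.continuousOn.integrableOn_Icc).mono_set Ioo_subset_Icc_self
    exact (integrable_map_measure continuous_logCap.aestronglyMeasurable
      measurable_snd.aemeasurable).1 this
  have e1 : ∀ᵐ p ∂(joint c β), ∫ q, {r : (ℝ × ℝ) × (ℝ × ℝ) | r.2.2 < r.1.2}.indicator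
      (fun r => log (r.1.1 - r.2.1)) (p, q) ∂(joint c β)
      = (pot c β p.1 - pot c β (base c β)) / 2 + logCap c β p.2 := by
    filter_upwards [ae_joint_mem hc1] with p hp
    have hx : 0 < p.1 := (lower_nonneg hc1 _).trans_lt hp.2.1
    -- As `x` is inside the support at time `T`, duality puts `T` inside `[lower x, upper x]`, where
    -- the Green integral is complete.
    have hd := duality hc0 hc1 hβ hx.le hp.1.1.le
    have hl := lower_le_upper (β := β) hc1 p.1
    have hpos : 0 < (p.2 - lower c β p.1) * (upper c β p.1 - p.2) := by
      rw [← hd]; exact mul_pos (by linarith [hp.2.1]) (by linarith [hp.2.2])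
    have h1 : lower c β p.1 ≤ p.2 := by
      by_contra! H
      nlinarith [mul_pos (sub_pos.2 H) (show 0 < upper c β p.1 - p.2 by linarith)]
    have h2 : p.2 ≤ upper c β p.1 := by
      by_contra! H
      nlinarith [mul_pos (sub_pos.2 H) (show 0 < p.2 - lower c β p.1 by linarith)]
    rw [← integral_green_of_mem hc0 hc1 hβ hx h1 h2, add_comm,
      ← integral_arcPot hc0 hc1 hβ _ hp.1.1.le hp.1.2.le,
      ← integral_indicator_log_sub_joint hc0 hc1 hβ _ hp.1.2.le]
    rfl
  have e2 : ∫ p, logCap c β p.2 ∂(joint c β) = ∫ T in Ioo 0 1, logCap c β T := by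
    rw [← map_snd_joint hc0 hc1 hβ, integral_map measurable_snd.aemeasurable
      continuous_logCap.aestronglyMeasurable]
  have i3 : Integrable (fun p : ℝ × ℝ => (pot c β p.1 - pot c β (base c β)) / 2) (joint c β) :=
    (i1.sub (integrable_const _)).div_const 2
  rw [integral_congr_ae e1, integral_add i3 i2,
    integral_div, integral_sub i1 (integrable_const _), e2,
    integral_comp_fst_joint hc0 hc1 hβ (continuous_pot c β).stronglyMeasurable]
  simp
  ring

theorem integral_mul_log_shift (b : ℝ) (hb : 0 ≤ b) :
    ∫ T in (0)..1, (T + b) * log (T + b)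
      = ((1 + b) ^ 2 * log (1 + b) - b ^ 2 * log b) / 2 - (1 + 2 * b) / 4 := by
  -- The antiderivative `u² log u / 2 - u² / 4`, grouped around `u log u` so that continuity at `u =
  -- 0` is visible.
  have hcont : Continuous fun x : ℝ => (x + b) * ((x + b) * log (x + b)) / 2 - (x + b) ^ 2 / 4 := by
    have h2 : Continuous fun x : ℝ => (x + b) * log (x + b) :=
      continuous_mul_log.comp (continuous_id.add continuous_const)
    fun_prop
  have hint : IntervalIntegrable (fun x : ℝ => (x + b) * log (x + b)) volume 0 1 :=
    (continuous_mul_log.comp (continuous_id.add continuous_const)).intervalIntegrable 0 1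
  rw [intervalIntegral.integral_eq_sub_of_hasDerivAt_of_le zero_le_one hcont.continuousOn ?_ hint]
  · simp only [zero_add]
    ring
  · intro x hx
    have hxb : x + b ≠ 0 := by linarith [hx.1]
    have h1 := (hasDerivAt_mul_log hxb).comp_add_const x b
    have h2 := (hasDerivAt_id x).add_const b
    refine (((h2.mul h1).div_const 2).sub ((h2.pow 2).div_const 4)).congr_deriv ?_
    simp
    ring

theorem integral_logCap (hβ : 0 ≤ β) : ∫ T in Ioo 0 1, logCap c β T
    = (log c / 2 - 1 / 4 + ((1 + β) ^ 2 * log (1 + β) - β ^ 2 * log β) / 2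
        - (1 + 2 * β) / 4 - β * log β) / 2 - 1 / 2 - log (1 - c) / 2 := by
  have h0 := integral_mul_log_shift 0 le_rfl
  simp only [add_zero] at h0
  have h1 : Continuous fun x : ℝ => x * log x := continuous_mul_log
  have h2 : Continuous fun x : ℝ => (x + β) * log (x + β) :=
    continuous_mul_log.comp (continuous_id.add continuous_const)
  have i0 : IntervalIntegrable (fun x : ℝ => x * (log c / 2 - 1 - log (1 - c)) - β * log β / 2)
    volume 0 1 := Continuous.intervalIntegrable (by fun_prop) _ _
  have e : logCap c β = fun T => (T * (log c / 2 - 1 - log (1 - c)) - β * log β / 2)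
      + (T * log T / 2 + (T + β) * log (T + β) / 2) := by
    ext T
    rw [logCap]
    ring
  have e3 : ∫ x in (0 : ℝ)..1, (x * (log c / 2 - 1 - log (1 - c)) - β * log β / 2)
      = (log c / 2 - 1 - log (1 - c)) / 2 - β * log β / 2 := by
    rw [intervalIntegral.integral_sub (Continuous.intervalIntegrable (by fun_prop) _ _)
      (Continuous.intervalIntegrable (by fun_prop) _ _), intervalIntegral.integral_mul_const,
      integral_id, intervalIntegral.integral_const]
    simp
    ring
  rw [e, ← integral_Ioc_eq_integral_Ioo, ← intervalIntegral.integral_of_le zero_le_one,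
    intervalIntegral.integral_add i0 (((h1.intervalIntegrable 0 1).div_const 2).add
      ((h2.intervalIntegrable 0 1).div_const 2)),
    intervalIntegral.integral_add ((h1.intervalIntegrable 0 1).div_const 2)
      ((h2.intervalIntegrable 0 1).div_const 2), e3, intervalIntegral.integral_div,
    intervalIntegral.integral_div, h0, integral_mul_log_shift β hβ]
  simp
  ring

theorem pot_base (hc0 : 0 < c) (hc1 : c < 1) (hβ : 0 ≤ β) :
    pot c β (base c β) = β - β * log β + β * log (1 - c) := by
  have hd : 0 < 1 - c := by linarith
  rcases hβ.eq_or_lt with rfl | hβ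
  · simp [pot, base]
  · have e1 : base c β + β = β / (1 - c) := by rw [base]; field_simp; ring
    rw [pot, e1, base, log_div (by positivity) hd.ne', log_div (by positivity) hd.ne',
      log_mul hc0.ne' hβ.ne']
    field_simp
    ring

/-- The energy of the equilibrium density. -/
theorem energy_eqDensity (hc0 : 0 < c) (hc1 : c < 1) (hβ : 0 ≤ β) :
    (∫ x, eqDensity c β x * pot c β x) - ∫ x, eqDensity c β x * eqPot c β x
      = (β + 1) * log (1 - c) - log c / 2
        + (β ^ 2 * log β - (β + 1) ^ 2 * log (β + 1) + 3 * (β + 1)) / 2 := by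
  rw [integral_eqDensity_mul_eqPot hc0 hc1 hβ, integral_logCap hβ, pot_base hc0 hc1 hβ,
    add_comm 1 β]
  ring

end Meixner

/-! ### Logarithmic energies of absolutely continuous measures. -/

namespace SixVertex

open Real Set Filter Topology LogKernel Meixner

theorem densityMeasure_eq (φ : ℝ → ℝ) : densityMeasure φ
    = volume.withDensity fun x => ENNReal.ofReal ((Ici (0 : ℝ)).indicator φ x) := by
  rw [densityMeasure, ← withDensity_indicator measurableSet_Ici]
  congr 1
  ext x
  by_cases hx : 0 ≤ x <;> simp [indicator, hx]

/-- The off-diagonal restriction is immaterial for measures that are absolutely continuous. -/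
theorem prod_restrict_offDiag {ν : Measure ℝ} [SFinite ν] (hν : ν ≪ volume) :
    (ν.prod ν).restrict {p : ℝ × ℝ | p.1 ≠ p.2} = ν.prod ν := by
  exact Measure.restrict_eq_self_of_ae_mem
    ((Measure.AbsolutelyContinuous.prod hν hν).ae_le ae_prod_ne)

theorem logEnergy_of_integrable {V : ℝ → ℝ} {ν : Measure ℝ} [SFinite ν] (hν : ν ≪ volume)
    (h : Integrable (fun p : ℝ × ℝ => kernel V p.1 p.2) (ν.prod ν)) :
    logEnergy V ν = ((∫ p, kernel V p.1 p.2 ∂(ν.prod ν) : ℝ) : EReal) := by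
  have hp : ∫⁻ p, ENNReal.ofReal (kernel V p.1 p.2) ∂(ν.prod ν) ≠ ∞ := h.lintegral_lt_top.ne
  have hn : ∫⁻ p, ENNReal.ofReal (-kernel V p.1 p.2) ∂(ν.prod ν) ≠ ∞ :=
    h.neg.lintegral_lt_top.ne
  rw [logEnergy, prod_restrict_offDiag hν, integral_eq_lintegral_pos_part_sub_lintegral_neg_part h,
    EReal.coe_sub, EReal.coe_ennreal_toReal hp, EReal.coe_ennreal_toReal hn]

/-- The lower bound keeps the negative part finite, so only the positive part can diverge. -/
theorem logEnergy_eq_top_or_integrable {V : ℝ → ℝ} (hV : Measurable V) {ν : Measure ℝ}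
    [IsFiniteMeasure ν] (hν : ν ≪ volume) {C : ℝ}
    (hC : ∀ᵐ p : ℝ × ℝ ∂(ν.prod ν), -C ≤ kernel V p.1 p.2) :
    logEnergy V ν = ⊤ ∨ Integrable (fun p : ℝ × ℝ => kernel V p.1 p.2) (ν.prod ν) := by
  have hm : Measurable fun p : ℝ × ℝ => kernel V p.1 p.2 := by
    unfold kernel
    exact ((measurable_log.comp (by fun_prop)).neg.add ((hV.comp measurable_fst).div_const 2)).add
      ((hV.comp measurable_snd).div_const 2)
  have hn : ∫⁻ p, ENNReal.ofReal (-kernel V p.1 p.2) ∂(ν.prod ν) ≠ ∞ := by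
    refine ne_top_of_le_ne_top (b := ∫⁻ _, ENNReal.ofReal C ∂(ν.prod ν)) ?_
      (lintegral_mono_ae (hC.mono fun p hp => ENNReal.ofReal_le_ofReal (by linarith)))
    rw [lintegral_const]
    exact ENNReal.mul_ne_top ENNReal.ofReal_ne_top (measure_ne_top _ _)
  by_cases hp : ∫⁻ p, ENNReal.ofReal (kernel V p.1 p.2) ∂(ν.prod ν) = ∞
  · left
    rw [logEnergy, prod_restrict_offDiag hν, hp, EReal.coe_ennreal_top, EReal.top_sub]
    simpa using hn
  · right
    refine ⟨hm.aestronglyMeasurable, ?_⟩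
    rw [hasFiniteIntegral_iff_norm]
    refine lt_of_le_of_lt (lintegral_mono fun p => ?_)
      (lt_of_eq_of_lt (lintegral_add_left hm.ennreal_ofReal _)
        (ENNReal.add_lt_top.2 ⟨lt_top_iff_ne_top.2 hp, lt_top_iff_ne_top.2 hn⟩))
    rcases le_total 0 (kernel V p.1 p.2) with h | h
    · rw [norm_of_nonneg h]; exact le_self_add
    · rw [norm_of_nonpos h]; exact le_add_self

theorem log_abs_sub_le {x y : ℝ} (hx : 0 ≤ x) (hy : 0 ≤ y) :
    log |x - y| ≤ log (1 + x) + log (1 + y) := by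
  rw [← log_mul (by positivity) (by positivity)]
  rcases (abs_nonneg (x - y)).eq_or_lt with h | h
  · rw [← h, log_zero]
    exact log_nonneg (by nlinarith)
  · refine log_le_log h ?_
    rw [abs_le]
    constructor <;> nlinarith [mul_nonneg hx hy]

theorem kernel_lower_bound {V : ℝ → ℝ} {ε C : ℝ}
    (hV : ∀ x, 0 ≤ x → ε * x - C ≤ V x - 2 * log (1 + x)) {x y : ℝ} (hx : 0 ≤ x) (hy : 0 ≤ y) :
    ε / 2 * (x + y) - C ≤ kernel V x y := by
  have h1 := hV x hx
  have h2 := hV y hy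
  have h3 := log_abs_sub_le hx hy
  rw [kernel]
  linarith

theorem ae_prod_of_ae_ae {p q : ℝ → Prop} (hp : ∀ᵐ x : ℝ, p x) (hq : ∀ᵐ x : ℝ, q x) :
    ∀ᵐ r : ℝ × ℝ ∂(volume.prod volume), p r.1 ∧ q r.2 := by
  have h1 : ∀ᵐ r : ℝ × ℝ ∂((volume : Measure ℝ).prod (volume : Measure ℝ)), p r.1 :=
    Measure.quasiMeasurePreserving_fst.ae hp
  have h2 : ∀ᵐ r : ℝ × ℝ ∂((volume : Measure ℝ).prod (volume : Measure ℝ)), q r.2 :=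
    Measure.quasiMeasurePreserving_snd.ae hq
  filter_upwards [h1, h2] with r h1 h2 using ⟨h1, h2⟩

/-! ### Competitors of finite energy and minimality of the equilibrium density. -/

section Competitor

variable {V f : ℝ → ℝ}

/-- The kernel dominates a multiple of `x + y` on the quadrant, so finite energy controls the first
moment. -/
theorem integrable_first_moment {ε C : ℝ} (hε : 0 < ε)
    (hV : ∀ x, 0 ≤ x → ε * x - C ≤ V x - 2 * log (1 + x))
    (hf : Integrable f) (hf0 : ∀ᵐ x, 0 ≤ f x) (hneg : ∀ x, x < 0 → f x = 0) (h1 : ∫ x, f x = 1)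
    (hk : Integrable (fun p : ℝ × ℝ => f p.1 * f p.2 * kernel V p.1 p.2) (volume.prod volume)) :
    Integrable fun x => x * f x := by
  have hff : Integrable (fun p : ℝ × ℝ => f p.1 * f p.2) (volume.prod volume) := hf.mul_prod hf
  have hx : Integrable (fun p : ℝ × ℝ => (p.1 * f p.1) * f p.2) (volume.prod volume) := by
    refine Integrable.mono' ((hk.add (hff.const_mul C)).const_mul (2 / ε)) ?_ ?_
    · exact ((continuous_fst.aestronglyMeasurable).mul hf.1.comp_fst).mul hf.1.comp_snd
    · filter_upwards [ae_prod_of_ae_ae hf0 hf0] with p hp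
      simp only [Pi.add_apply]
      rcases lt_or_ge p.1 0 with h | h
      · simp [hneg _ h]
      rcases lt_or_ge p.2 0 with h' | h'
      · simp [hneg _ h']
      have hb := kernel_lower_bound hV h h'
      have hff0 := mul_nonneg hp.1 hp.2
      rw [norm_of_nonneg (mul_nonneg (mul_nonneg h hp.1) hp.2)]
      have : p.1 ≤ 2 / ε * (kernel V p.1 p.2 + C) := by
        rw [div_mul_eq_mul_div, le_div_iff₀ hε]
        nlinarith
      calc p.1 * f p.1 * f p.2 = p.1 * (f p.1 * f p.2) := by ring
        _ ≤ 2 / ε * (kernel V p.1 p.2 + C) * (f p.1 * f p.2) := by gcongr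
        _ = _ := by ring
  have := hx.integral_prod_left
  simpa only [integral_const_mul, h1, mul_one] using this

/-- Adding the logarithm back to the kernel leaves `(V x + V y) / 2`. A section at some `y` with `f
y ≠ 0` is integrable, and `V x` is read off from it. -/
theorem integrable_potential (hf : Integrable f) (hf0 : ∀ᵐ x, |f x| ≤ 1) (h1 : ∫ x, f x = 1)
    (hfx : Integrable fun x => x * f x)
    (hk : Integrable (fun p : ℝ × ℝ => f p.1 * f p.2 * kernel V p.1 p.2) (volume.prod volume)) :
    Integrable fun x => f x * V x := by
  have hlog := integrable_mul_mul_log_sub hf hf hf0 hfx hfx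
  have h := (hk.add hlog).prod_left_ae
  have hne : ∃ y, f y ≠ 0 ∧ Integrable fun x => f x * f y * kernel V x y
      + f x * f y * log (x - y) := by
    by_contra! H
    have : ∀ᵐ y, f y = 0 := h.mono fun y hy => by
      by_contra H'
      exact H y H' hy
    rw [integral_congr_ae this] at h1
    simp at h1
  obtain ⟨y, hy, hI⟩ := hne
  refine ((hI.const_mul (2 / f y)).sub (hf.mul_const (V y))).congr
    (Eventually.of_forall fun x => ?_)
  simp only [Pi.sub_apply, kernel, log_abs]
  field_simp
  ring

theorem integral_kernel (hf : Integrable f) (hf0 : ∀ᵐ x, |f x| ≤ 1) (h1 : ∫ x, f x = 1)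
    (hfx : Integrable fun x => x * f x) (hfV : Integrable fun x => f x * V x) :
    Integrable (fun p : ℝ × ℝ => f p.1 * f p.2 * kernel V p.1 p.2) (volume.prod volume) ∧
      ∫ p : ℝ × ℝ, f p.1 * f p.2 * kernel V p.1 p.2 ∂(volume.prod volume)
        = (∫ x, f x * V x)
          - ∫ p : ℝ × ℝ, f p.1 * f p.2 * log (p.1 - p.2) ∂(volume.prod volume) := by
  have hlog := integrable_mul_mul_log_sub hf hf hf0 hfx hfx
  have i1 : Integrable (fun p : ℝ × ℝ => (f p.1 * V p.1) * f p.2) (volume.prod volume) :=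
    hfV.mul_prod hf
  have i2 : Integrable (fun p : ℝ × ℝ => f p.1 * (f p.2 * V p.2)) (volume.prod volume) :=
    hf.mul_prod hfV
  have i3 : Integrable (fun p : ℝ × ℝ => (f p.1 * V p.1) * f p.2 / 2 + f p.1 * (f p.2 * V p.2) / 2)
      (volume.prod volume) := (i1.div_const 2).add (i2.div_const 2)
  have e : (fun p : ℝ × ℝ => f p.1 * f p.2 * kernel V p.1 p.2) = fun p =>
      ((f p.1 * V p.1) * f p.2 / 2 + f p.1 * (f p.2 * V p.2) / 2)
        - f p.1 * f p.2 * log (p.1 - p.2) := by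
    ext p
    rw [kernel, log_abs]
    ring
  rw [e]
  refine ⟨i3.sub hlog, ?_⟩
  rw [integral_sub i3 hlog, integral_add (i1.div_const 2) (i2.div_const 2), integral_div,
    integral_div, integral_prod_mul (fun x => f x * V x) f,
    integral_prod_mul f (fun x => f x * V x), h1]
  ring

variable {c β : ℝ}

theorem integral_mul_log_eqDensity (hc0 : 0 < c) (hc1 : c < 1) (hβ : 0 ≤ β) (hf : Integrable f)
    (hfx : Integrable fun x => x * f x) :
    Integrable (fun p : ℝ × ℝ => f p.1 * eqDensity c β p.2 * log (p.1 - p.2))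
      (volume.prod volume) ∧ Integrable (fun x => f x * eqPot c β x) ∧
    ∫ p : ℝ × ℝ, f p.1 * eqDensity c β p.2 * log (p.1 - p.2) ∂(volume.prod volume)
      = ∫ x, f x * eqPot c β x := by
  have h := integrable_mul_mul_log_sub hf (integrable_eqDensity hc0 hc1 hβ)
    (Eventually.of_forall (abs_eqDensity_le hc0 hc1 hβ)) hfx
    (integrable_continuous_mul_eqDensity hc0 hc1 hβ continuous_id)
  have e : ∀ x, ∫ y, f x * eqDensity c β y * log (x - y) = f x * eqPot c β x := by
    intro x
    rw [eqPot, ← integral_const_mul]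
    simp only [mul_assoc]
  refine ⟨h, ?_, ?_⟩
  · have := h.integral_prod_left
    simpa only [e] using this
  · rw [integral_prod _ h]
    simp only [e]

/-- Conditional negative definiteness applied to `f - ψ`, which has integral zero, and expanded by
bilinearity. -/
theorem integral_log_le (hc0 : 0 < c) (hc1 : c < 1) (hβ : 0 ≤ β) (hf : Integrable f)
    (hf0 : ∀ᵐ x, 0 ≤ f x ∧ f x ≤ 1) (h1 : ∫ x, f x = 1) (hfx : Integrable fun x => x * f x) :
    ∫ p : ℝ × ℝ, f p.1 * f p.2 * log (p.1 - p.2) ∂(volume.prod volume)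
      ≤ 2 * (∫ x, f x * eqPot c β x) - ∫ x, eqDensity c β x * eqPot c β x := by
  set ψ := eqDensity c β with hψ
  have iψ : Integrable ψ := integrable_eqDensity hc0 hc1 hβ
  have iψx : Integrable fun x => x * ψ x :=
    integrable_continuous_mul_eqDensity hc0 hc1 hβ continuous_id
  have hf1 : ∀ᵐ x, |f x| ≤ 1 := hf0.mono fun x hx => by rw [abs_of_nonneg hx.1]; exact hx.2
  have hff := integrable_mul_mul_log_sub hf hf hf1 hfx hfx
  obtain ⟨h2, -, h2'⟩ := integral_mul_log_eqDensity hc0 hc1 hβ hf hfx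
  obtain ⟨h3, -, h3'⟩ := integral_mul_log_eqDensity hc0 hc1 hβ iψ iψx
  rw [← hψ] at h2 h2' h3 h3'
  have h4 : Integrable (fun p : ℝ × ℝ => ψ p.1 * f p.2 * log (p.1 - p.2)) (volume.prod volume) :=
    integrable_mul_mul_log_sub iψ hf hf1 iψx hfx
  have h4' : ∫ p : ℝ × ℝ, ψ p.1 * f p.2 * log (p.1 - p.2) ∂(volume.prod volume)
      = ∫ x, f x * eqPot c β x := by
    rw [← h2', ← integral_prod_swap]
    refine integral_congr_ae (Eventually.of_forall fun p => ?_)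
    simp only [Prod.fst_swap, Prod.snd_swap]
    rw [← log_abs, abs_sub_comm, log_abs]
    ring
  have key := integral_mul_log_nonpos (f := fun x => f x - ψ x) (hf.sub iψ)
    (hf0.mono fun x hx => abs_le.2 ⟨by
      have := eqDensity_le_one hc0 hc1 hβ x; simp only [hψ]; linarith, by
      have := eqDensity_nonneg (c := c) (β := β) x; simp only [hψ]; linarith⟩)
    ((hfx.sub iψx).congr (Eventually.of_forall fun x => by simp only [Pi.sub_apply]; ring))
    (by rw [integral_sub hf iψ, h1, hψ, integral_eqDensity hc0 hc1 hβ, sub_self])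
  have i1 : Integrable (fun p : ℝ × ℝ => f p.1 * f p.2 * log (p.1 - p.2)
      - f p.1 * ψ p.2 * log (p.1 - p.2)) (volume.prod volume) := hff.sub h2
  have i2 : Integrable (fun p : ℝ × ℝ => ψ p.1 * f p.2 * log (p.1 - p.2)
      - ψ p.1 * ψ p.2 * log (p.1 - p.2)) (volume.prod volume) := h4.sub h3
  have e : (fun p : ℝ × ℝ => (f p.1 - ψ p.1) * (f p.2 - ψ p.2) * log (p.1 - p.2)) = fun p =>
      (f p.1 * f p.2 * log (p.1 - p.2) - f p.1 * ψ p.2 * log (p.1 - p.2))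
      - (ψ p.1 * f p.2 * log (p.1 - p.2) - ψ p.1 * ψ p.2 * log (p.1 - p.2)) := by
    ext p; ring
  rw [e, integral_sub i1 i2, integral_sub hff h2, integral_sub h4 h3, h2', h3', h4'] at key
  linarith

/-- Minimality of the equilibrium density, given the Euler–Lagrange inequalities for `V`. -/
theorem energy_le_integral_kernel (hc0 : 0 < c) (hc1 : c < 1) (hβ : 0 ≤ β) (hf : Integrable f)
    (hf0 : ∀ᵐ x, 0 ≤ f x ∧ f x ≤ 1) (h1 : ∫ x, f x = 1) (hfx : Integrable fun x => x * f x)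
    (hfV : Integrable fun x => f x * V x)
    (hψV : ∀ x, eqDensity c β x * V x = eqDensity c β x * pot c β x)
    (hEL : ∀ᵐ x, 0 ≤ (V x - pot c β (base c β) - 2 * eqPot c β x + 2 * logCap c β 1)
      * (f x - eqDensity c β x)) :
    (∫ x, eqDensity c β x * pot c β x) - (∫ x, eqDensity c β x * eqPot c β x)
      ≤ ∫ p : ℝ × ℝ, f p.1 * f p.2 * kernel V p.1 p.2 ∂(volume.prod volume) := by
  have hf1 : ∀ᵐ x, |f x| ≤ 1 := hf0.mono fun x hx => by rw [abs_of_nonneg hx.1]; exact hx.2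
  have hlog := integral_log_le hc0 hc1 hβ hf hf0 h1 hfx
  have iψ := integrable_eqDensity hc0 hc1 hβ
  have iψx := integrable_continuous_mul_eqDensity hc0 hc1 hβ continuous_id
  have iψV : Integrable fun x => eqDensity c β x * pot c β x := by
    simpa only [mul_comm] using
      integrable_continuous_mul_eqDensity hc0 hc1 hβ (continuous_pot c β)
  obtain ⟨-, ifU, -⟩ := integral_mul_log_eqDensity hc0 hc1 hβ hf hfx
  obtain ⟨-, iψU, -⟩ := integral_mul_log_eqDensity hc0 hc1 hβ iψ iψx
  have hpos := integral_nonneg_of_ae hEL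
  have j1 : Integrable fun x => f x * V x - 2 * (f x * eqPot c β x) := hfV.sub (ifU.const_mul 2)
  have j2 : Integrable fun x => eqDensity c β x * pot c β x
      - 2 * (eqDensity c β x * eqPot c β x) := iψV.sub (iψU.const_mul 2)
  -- The constant part of the Euler–Lagrange expression integrates to zero, because `f` and the
  -- equilibrium density have equal mass.
  have j3 : Integrable fun x => (f x - eqDensity c β x)
      * (pot c β (base c β) - 2 * logCap c β 1) := (hf.sub iψ).mul_const _
  have j4 : Integrable fun x => (f x * V x - 2 * (f x * eqPot c β x))
      - (eqDensity c β x * pot c β x - 2 * (eqDensity c β x * eqPot c β x)) := j1.sub j2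
  have e : (fun x => (V x - pot c β (base c β) - 2 * eqPot c β x + 2 * logCap c β 1)
      * (f x - eqDensity c β x)) = fun x => ((f x * V x - 2 * (f x * eqPot c β x))
      - (eqDensity c β x * pot c β x - 2 * (eqDensity c β x * eqPot c β x)))
      - (f x - eqDensity c β x) * (pot c β (base c β) - 2 * logCap c β 1) := by
    ext x
    rw [← hψV]
    ring
  rw [e, integral_sub j4 j3, integral_sub j1 j2, integral_sub hfV (ifU.const_mul 2),
    integral_sub iψV (iψU.const_mul 2), integral_mul_const, integral_sub hf iψ, h1,
    integral_eqDensity hc0 hc1 hβ, integral_const_mul, integral_const_mul] at hpos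
  rw [(integral_kernel hf hf1 h1 hfx hfV).2]
  linarith

end Competitor

end SixVertex

/-! ### The external field with a distant kink, and the conclusion. -/

namespace SixVertex

open Real Set Filter Topology LogKernel Meixner

variable {a q α s : ℝ}

theorem externalField_eq (ha0 : 0 < a) (hq0 : 0 < q) (hα : 1 ≤ α) {x : ℝ} (hx : 0 ≤ x) :
    externalField a q α s x = pot (a * q) (α - 1) x - log q⁻¹ * (x - min x s) := by
  rw [externalField, pot, log_mul ha0.ne' hq0.ne', log_inv, log_inv,
    show x + α - 1 = x + (α - 1) by ring]
  rcases hx.eq_or_lt with rfl | hx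
  · simp
    ring
  · rw [log_div hx.ne' (by linarith)]
    ring

theorem measurable_externalField : Measurable (externalField a q α s) := by
  unfold externalField
  have h1 : Measurable fun x : ℝ => log (x + α - 1) := measurable_log.comp (by fun_prop)
  have h2 : Measurable fun x : ℝ => log (x / (x + α - 1)) := measurable_log.comp (by fun_prop)
  fun_prop

/-- A lower bound for the external field, uniform in the position of its kink. -/
theorem exists_le_externalField (ha0 : 0 < a) (ha1 : a < 1) (hq0 : 0 < q) (hq1 : q < 1)
    (hα : 1 ≤ α) : ∃ C, ∀ s, 0 ≤ s → ∀ x, 0 ≤ x →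
      log a⁻¹ / 2 * x - C ≤ externalField a q α s x - 2 * log (1 + x) := by
  have hA : 0 < log a⁻¹ := log_pos ((one_lt_inv₀ ha0).2 ha1)
  have hQ : 0 < log q⁻¹ := log_pos ((one_lt_inv₀ hq0).2 hq1)
  -- The logarithms to absorb amount to at most `(α - 1) + 2 = α + 1` copies of `log (x + α)`. The
  -- tangent line of slope `δ` bounds each, and this `δ` makes them use up half of the slope `log
  -- a⁻¹`.
  set δ := log a⁻¹ / (2 * (α + 1)) with hδ
  have hδ0 : 0 < δ := by positivity
  have hδ2 : (α + 1) * δ = log a⁻¹ / 2 := by rw [hδ]; field_simp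
  refine ⟨(α + 1) * (δ * α - 1 - log δ), fun s hs x hx => ?_⟩
  have hlog : log (x + α) ≤ δ * (x + α) - 1 - log δ := by
    have := log_le_sub_one_of_pos (show 0 < δ * (x + α) by positivity)
    rw [log_mul hδ0.ne' (by positivity)] at this
    linarith
  have h1 : log (x + α - 1) ≤ log (x + α) := by
    rcases (show 0 ≤ x + α - 1 by linarith).eq_or_lt with h | h
    · rw [← h, log_zero]; exact log_nonneg (by linarith)
    · exact log_le_log h (by linarith)
  have h2 : log (1 + x) ≤ log (x + α) := log_le_log (by linarith) (by linarith)
  have h3 : -(α - 1) ≤ x * log (x / (x + α - 1)) := by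
    rcases hx.eq_or_lt with rfl | hx
    · simp; linarith
    · have h := one_sub_inv_le_log_of_pos
        (show 0 < x / (x + α - 1) from div_pos hx (by linarith))
      have h' : x * (1 - (x / (x + α - 1))⁻¹) = -(α - 1) := by
        rw [inv_div]; field_simp; ring
      rw [← h']
      exact mul_le_mul_of_nonneg_left h hx.le
  have h4 : 0 ≤ log q⁻¹ * min x s := mul_nonneg hQ.le (le_min hx hs)
  have h5 : (α - 1) * log (x + α - 1) ≤ (α - 1) * log (x + α) :=
    mul_le_mul_of_nonneg_left h1 (by linarith)
  have h6 : (α + 1) * log (x + α) ≤ (α + 1) * (δ * (x + α) - 1 - log δ) :=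
    mul_le_mul_of_nonneg_left hlog (by linarith)
  have h7 : (α + 1) * (δ * (x + α) - 1 - log δ)
      = log a⁻¹ / 2 * x + (α + 1) * (δ * α - 1 - log δ) := by
    rw [← hδ2]; ring
  rw [externalField]
  linarith

/-- To the right of the support, distances to its points are at most `x`, hence below `1 + x`. -/
theorem eqPot_le_log {c β : ℝ} (hc0 : 0 < c) (hc1 : c < 1) (hβ : 0 ≤ β) {x : ℝ}
    (hx : upper c β 1 ≤ x) : eqPot c β x ≤ log (1 + x) := by
  have h0 := integrable_mul_log_sub (integrable_eqDensity hc0 hc1 hβ)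
    (Eventually.of_forall (abs_eqDensity_le hc0 hc1 hβ))
    (integrable_continuous_mul_eqDensity hc0 hc1 hβ continuous_id) x
  have h1 : ∫ y, eqDensity c β y * log (1 + x) = log (1 + x) := by
    rw [integral_mul_const, integral_eqDensity hc0 hc1 hβ, one_mul]
  rw [← h1, eqPot]
  refine integral_mono h0 ((integrable_eqDensity hc0 hc1 hβ).mul_const _) fun y => ?_
  by_cases hy : y ∈ Ioo 0 (upper c β 1)
  · exact mul_le_mul_of_nonneg_left (log_le_log (by linarith [hy.2]) (by linarith [hy.1]))
      (eqDensity_nonneg y)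
  · simp [eqDensity_eq_zero_of_notMem hc0 hc1 hy]

theorem energy_value {α c : ℝ} (hc0 : 0 < c) (hc1 : c < 1) (hα : 1 ≤ α) :
    (∫ x, eqDensity c (α - 1) x * pot c (α - 1) x)
        - ∫ x, eqDensity c (α - 1) x * eqPot c (α - 1) x
      = α * log (1 - c) - log c / 2 - constC α := by
  rw [energy_eqDensity hc0 hc1 (by linarith), constC, show α - 1 + 1 = α by ring]
  ring

theorem eqDensity_mul_externalField (ha0 : 0 < a) (hq0 : 0 < q) (hc1 : a * q < 1) (hα : 1 ≤ α)
    (hs : upper (a * q) (α - 1) 1 ≤ s) (x : ℝ) :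
    eqDensity (a * q) (α - 1) x * externalField a q α s x
      = eqDensity (a * q) (α - 1) x * pot (a * q) (α - 1) x := by
  by_cases hx : x ∈ Ioo 0 (upper (a * q) (α - 1) 1)
  · rw [externalField_eq ha0 hq0 hα hx.1.le, min_eq_left (hx.2.le.trans hs)]
    ring
  · simp [eqDensity_eq_zero_of_notMem (mul_pos ha0 hq0) hc1 hx]

/-- The equilibrium energy does not depend on the position of a kink far from the origin. -/
theorem exists_fieldEnergy_eq (ha0 : 0 < a) (ha1 : a < 1) (hq0 : 0 < q) (hq1 : q < 1)
    (hα : 1 ≤ α) : ∃ s₀, ∀ s, s₀ ≤ s → fieldEnergy a q α s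
      = ((α * log (1 - a * q) - log (a * q) / 2 - constC α : ℝ) : EReal) := by
  obtain ⟨C, hC⟩ := exists_le_externalField ha0 ha1 hq0 hq1 hα
  have hA : 0 < log a⁻¹ := log_pos ((one_lt_inv₀ ha0).2 ha1)
  have hc0 : 0 < a * q := mul_pos ha0 hq0
  have hc1 : a * q < 1 := mul_lt_one_of_nonneg_of_lt_one_left ha0.le ha1 hq1.le
  have hβ : 0 ≤ α - 1 := by linarith
  set c := a * q with hc
  set β := α - 1 with hβd
  set L := pot c β (base c β) - 2 * logCap c β 1 with hL
  have hM : 0 < upper c β 1 := zero_lt_one.trans (lt_upper hc0 hc1 hβ one_pos)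
  -- The first threshold puts the kink beyond the support. The second makes `log a⁻¹ / 2 * x - C -
  -- L` nonnegative for `x ≥ s`, which is the Euler–Lagrange inequality where the field is no longer
  -- `pot`.
  refine ⟨max (upper c β 1) (2 * (C + L) / log a⁻¹), fun s hs => ?_⟩
  have hsM : upper c β 1 ≤ s := (le_max_left _ _).trans hs
  have hs0 : 0 ≤ s := hM.le.trans hsM
  have hgrow := hC s hs0
  have hψV : ∀ x, eqDensity c β x * externalField a q α s x = eqDensity c β x * pot c β x :=
    eqDensity_mul_externalField ha0 hq0 hc1 hα hsM
  rw [← energy_value hc0 hc1 hα]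
  apply le_antisymm
  · have hind : (Ici (0 : ℝ)).indicator (eqDensity c β) = eqDensity c β := by
      refine indicator_eq_self.2 fun x hx => ?_
      by_contra H
      exact hx (eqDensity_eq_zero_of_notMem hc0 hc1 fun h => H h.1.le)
    have hadm : eqDensity c β ∈ admissible := by
      refine ⟨(integrable_eqDensity hc0 hc1 hβ).integrableOn, Eventually.of_forall fun x =>
        ⟨eqDensity_nonneg x, eqDensity_le_one hc0 hc1 hβ x⟩, ?_⟩
      rw [← integral_indicator measurableSet_Ici, hind, integral_eqDensity hc0 hc1 hβ]
    refine (iInf₂_le _ hadm).trans (le_of_eq ?_)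
    have iψx := integrable_continuous_mul_eqDensity hc0 hc1 hβ continuous_id
    have iψV : Integrable fun x => eqDensity c β x * externalField a q α s x := by
      simp only [hψV]
      simpa only [mul_comm] using
        integrable_continuous_mul_eqDensity hc0 hc1 hβ (continuous_pot c β)
    obtain ⟨h1, h2⟩ := integral_kernel (integrable_eqDensity hc0 hc1 hβ)
      (Eventually.of_forall (abs_eqDensity_le hc0 hc1 hβ)) (integral_eqDensity hc0 hc1 hβ) iψx iψV
    have hm : AEMeasurable (fun p : ℝ × ℝ => eqDensity c β p.1 * eqDensity c β p.2)
        (volume.prod volume) := ((measurable_eqDensity.comp measurable_fst).mul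
          (measurable_eqDensity.comp measurable_snd)).aemeasurable
    have hp := withDensity_ofReal_prod (μ := volume) (measurable_eqDensity (c := c)
      (β := β)).aemeasurable (Eventually.of_forall eqDensity_nonneg)
    have hp0 := ae_nonneg_mul_prod (μ := volume) (f := eqDensity c β)
      (Eventually.of_forall eqDensity_nonneg)
    rw [densityMeasure_eq, hind, logEnergy_of_integrable (withDensity_absolutelyContinuous _ _),
      hp, integral_withDensity_ofReal hm hp0, h2,
      (integral_mul_log_eqDensity hc0 hc1 hβ (integrable_eqDensity hc0 hc1 hβ) iψx).2.2]
    · simp only [hψV]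
      rfl
    · rw [hp, integrable_withDensity_ofReal_iff hm hp0]
      exact h1
  · refine le_iInf₂ fun φ hφ => ?_
    obtain ⟨hφ1, hφ2, hφ3⟩ := hφ
    set f := (Ici (0 : ℝ)).indicator φ with hf
    have hfi : Integrable f := (integrable_indicator_iff measurableSet_Ici).2 hφ1
    have hf01 : ∀ᵐ x, 0 ≤ f x ∧ f x ≤ 1 := by
      rw [ae_restrict_iff' measurableSet_Ici] at hφ2
      filter_upwards [hφ2] with x hx
      by_cases h : x ∈ Ici (0 : ℝ)
      · rw [hf, indicator_of_mem h]; exact hx h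
      · rw [hf, indicator_of_notMem h]; exact ⟨le_rfl, zero_le_one⟩
    have hfn : ∀ x, x < 0 → f x = 0 := fun x hx => indicator_of_notMem (by simpa using hx) _
    have hf1 : ∫ x, f x = 1 := by rw [hf, integral_indicator measurableSet_Ici, hφ3]
    have hf0 : ∀ᵐ x, 0 ≤ f x := hf01.mono fun x h => h.1
    have hfa : ∀ᵐ x, |f x| ≤ 1 := hf01.mono fun x hx => by rw [abs_of_nonneg hx.1]; exact hx.2
    have hm : AEMeasurable (fun p : ℝ × ℝ => f p.1 * f p.2) (volume.prod volume) :=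
      (hfi.mul_prod hfi).1.aemeasurable
    have hp := withDensity_ofReal_prod hfi.1.aemeasurable hf0
    have hp0 := ae_nonneg_mul_prod hf0
    rw [densityMeasure_eq]
    set ν := volume.withDensity fun x => ENNReal.ofReal (f x) with hν
    have hν0 : ν ≪ volume := withDensity_absolutelyContinuous _ _
    have : IsFiniteMeasure ν := isFiniteMeasure_withDensity_ofReal hfi.2
    have hlow : ∀ᵐ p : ℝ × ℝ ∂(ν.prod ν), -C ≤ kernel (externalField a q α s) p.1 p.2 := by
      rw [hp, ae_withDensity_iff' hm.ennreal_ofReal]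
      refine Eventually.of_forall fun p hne => ?_
      have h1 : 0 ≤ p.1 := by
        by_contra! H
        exact hne (by simp [hfn _ H])
      have h2 : 0 ≤ p.2 := by
        by_contra! H
        exact hne (by simp [hfn _ H])
      have := kernel_lower_bound hgrow h1 h2
      have h3 : 0 ≤ log a⁻¹ / 2 / 2 * (p.1 + p.2) := by positivity
      linarith
    rcases logEnergy_eq_top_or_integrable measurable_externalField hν0 hlow with h | h
    · rw [h]; exact le_top
    rw [logEnergy_of_integrable hν0 h, EReal.coe_le_coe_iff, hp,
      integral_withDensity_ofReal hm hp0]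
    rw [hp, integrable_withDensity_ofReal_iff hm hp0] at h
    have hfx := integrable_first_moment (by positivity) hgrow hfi hf0 hfn hf1 h
    refine energy_le_integral_kernel hc0 hc1 hβ hfi hf01 hf1 hfx
      (integrable_potential hfi hfa hf1 hfx h) hψV ?_
    have hne : ∀ᵐ x : ℝ, x ≠ 0 := by simp [ae_iff]
    filter_upwards [hf01, hne] with x hx hx0
    rcases lt_or_gt_of_ne hx0 with hneg | hpos
    · rw [hfn x hneg, eqDensity_eq_zero_of_notMem hc0 hc1 fun h => absurd h.1 hneg.not_gt]
      simp
    rcases le_or_gt x s with hxs | hxs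
    · have hE : externalField a q α s x - pot c β (base c β) - 2 * eqPot c β x
          + 2 * logCap c β 1 = excess c β x := by
        rw [externalField_eq ha0 hq0 hα hpos.le, min_eq_left hxs, excess]
        ring
      rw [hE]
      rcases excess_trichotomy hc0 hc1 hβ hpos with ⟨h1, h2⟩ | h1 | ⟨h1, h2⟩
      · rw [h2, sub_zero]; exact mul_nonneg h1 hx.1
      · rw [h1, zero_mul]
      · rw [h2]; exact mul_nonneg_of_nonpos_of_nonpos h1 (by linarith [hx.2])
    -- Beyond the kink the equilibrium density is zero, so only the sign of the effective potential
    -- matters, and growth supplies it.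
    · have hψ0 : eqDensity c β x = 0 :=
        eqDensity_eq_zero_of_notMem hc0 hc1 fun h => by linarith [h.2]
      rw [hψ0, sub_zero]
      refine mul_nonneg ?_ hx.1
      have h1 := hgrow x hpos.le
      have h2 := eqPot_le_log hc0 hc1 hβ (hsM.trans hxs.le)
      have h3 : 2 * (C + L) / log a⁻¹ ≤ x := ((le_max_right _ _).trans hs).trans hxs.le
      rw [div_le_iff₀ hA] at h3
      linarith

theorem integral_max_eq (hα0 : 0 < α) (hα1 : α < 1) (hs : 1 ≤ s) :
    ∫ x in α..1, max (s + x - 1) 0 = (1 - α) * (s - 1) + (1 - α ^ 2) / 2 := by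
  have : ∫ x in α..1, max (s + x - 1) 0 = ∫ x in α..1, (x + (s - 1)) := by
    refine intervalIntegral.integral_congr fun x hx => ?_
    rw [uIcc_of_le hα1.le] at hx
    rw [max_eq_left (by linarith [hx.1])]
    ring
  rw [this, intervalIntegral.integral_add (Continuous.intervalIntegrable (by fun_prop) _ _)
    (Continuous.intervalIntegrable (by fun_prop) _ _), integral_id,
    intervalIntegral.integral_const, smul_eq_mul]
  ring

end SixVertex

theorem proposition3p5 (a q α : ℝ) (ha0 : 0 < a) (ha1 : a < 1) (hq0 : 0 < q) (hq1 : q < 1)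
    (hα : 0 < α) :
    ∃ s₀ : ℝ, ∀ s : ℝ, s₀ ≤ s →
      SixVertex.rateF a q α s =
        ((Real.log q⁻¹ * ((s - 1) ^ 2 / 2)
          + α * Real.log ((1 - a * q) / (1 - a)) : ℝ) : EReal) := by
  have hc1 : a * q < 1 := mul_lt_one_of_nonneg_of_lt_one_left ha0.le ha1 hq1.le
  have hd : Real.log ((1 - a * q) / (1 - a)) = Real.log (1 - a * q) - Real.log (1 - a) :=
    Real.log_div (by linarith) (by linarith)
  have hlog : Real.log (a * q) = Real.log a + Real.log q := Real.log_mul ha0.ne' hq0.ne'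
  rcases le_or_gt 1 α with h1 | h1
  · obtain ⟨s₀, h⟩ := SixVertex.exists_fieldEnergy_eq ha0 ha1 hq0 hq1 h1
    refine ⟨s₀, fun s hs => ?_⟩
    rw [SixVertex.rateF, if_pos h1, h s hs, ← EReal.coe_add, EReal.coe_eq_coe_iff, hd, hlog,
      Real.log_inv]
    ring
  · obtain ⟨s₀, h⟩ := SixVertex.exists_fieldEnergy_eq ha0 ha1 hq0 hq1
      ((one_le_inv₀ hα).2 h1.le)
    -- `1 ≤ s` removes the positive part from the integral over `[α, 1]`; the other bound says that
    -- the rescaled argument `s * α⁻¹ - α⁻¹ + 1` is at least `s₀`.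
    refine ⟨max 1 (α * (s₀ - 1) + 1), fun s hs => ?_⟩
    have hs1 : 1 ≤ s := (le_max_left _ _).trans hs
    have hs2 : s₀ ≤ s * α⁻¹ - α⁻¹ + 1 := by
      have h2 : α * (s₀ - 1) ≤ s - 1 := by linarith [(le_max_right _ _).trans hs]
      have h3 : s₀ - 1 ≤ α⁻¹ * (s - 1) := by rwa [le_inv_mul_iff₀ hα]
      linarith
    rw [SixVertex.rateF, if_neg (not_le.2 h1), h _ hs2, SixVertex.integral_max_eq hα h1 hs1,
      ← EReal.coe_mul, ← EReal.coe_add, EReal.coe_eq_coe_iff, hd, hlog, Real.log_inv]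
    field_simp
    ring
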